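/- Let $u_0\in C^2([0,1])$ be real-valued with $u_0(0)=0$, and let $j:[0,\infty)\to\mathbb R$ have a piecewise continuous derivative: on every bounded interval $(0,T)$, $j$ is continuously differentiable off a finite set, and $j'$ has finite one-sided limits at every point (corners and jumps of $j$ at the exceptional points are allowed). No compatibility between $u_0$ and $j$ is assumed at $x=1$, that is, $u_0'(1)-u_0(1)$ need not equal $j(0)$. Put $$\hat u_0(\lambda)=\int_0^1 e^{\lambda x}u_0(x)\,dx,\qquad \hat j(\lambda,t)=\int_0^t e^{\lambda s}j(s)\,ds,\qquad \Delta(\lambda)=e^{-i\lambda}(1+i\lambda)-e^{i\lambda}(1-i\lambda),$$ $$\mu_0(\lambda)=(i\lambda+1)e^{-i\lambda}\hat u_0(i\lambda)+(i\lambda-1)e^{i\lambda}\hat u_0(-i\lambda)+2i\lambda\,\hat j(\lambda^2,t),\qquad \mu_1(\lambda)=\mu_0(\lambda)-\Delta(\lambda)\hat u_0(-i\lambda),$$ and, for $\varepsilon>0$, $D_+=\{w+i\varepsilon:\ \tfrac{\pi}{4}\le\arg w\le\tfrac{3\pi}{4}\}$ and $D_-=\{w-i\varepsilon:\ \tfrac{5\pi}{4}\le\arg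 w\le\tfrac{7\pi}{4}\}$, with boundaries oriented so that the sector lies on the left. Consider the integral representation $$u(x,t)=\frac1{2\pi}\left\{\int_{-\infty}^{\infty}e^{i\lambda x-\lambda^2t}\,\hat u_0(-i\lambda)\,d\lambda-\int_{\partial D_+}\frac{e^{i\lambda x-\lambda^2t}}{\Delta(\lambda)}\,\mu_0(\lambda)\,d\lambda-\int_{\partial D_-}\frac{e^{i\lambda x-\lambda^2t}}{\Delta(\lambda)}\,\mu_1(\lambda)\,d\lambda\right\}$$ of the solution of $\partial_tu=\partial_x^2u$ $(0<x<1,\ t>0)$, $u(x,0)=u_0(x)$, $u(0,t)=0$, $(\partial_xu-u)(1,t)=j(t)$. Then for all $0<x<1$ and $t>0$ the three integrals converge absolutely, and the right-hand side has the same value $u(x,t)$, for every $\varepsilon>0$ with $2\varepsilon t<\min(x,1-x)$; for each $t>0$ the function $u(\cdot,t)$ extends continuously to $[0,1]$; and, with this extension, $$\lim_{t\downarrow0}\ \sup_{0\le x\le1}|u(x,t)-u_0(x)|=0 .$$ In particular $u(1,t)\to u_0(1)$ at the boundary $x=1$. -/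

import Mathlib

open Set Filter Topology MeasureTheory

noncomputable section

namespace SingleParticle

/-- `j`, regarded as a function on `[0, ∞)`, has a piecewise continuous derivative: on every bounded
interval `(0, T)` it is differentiable with continuous derivative off a finite set, and the
derivative has finite one-sided limits everywhere. At the exceptional points `j` may have a corner
or a jump. -/
def HasPiecewiseContinuousDeriv (j : ℝ → ℝ) : Prop :=
  ∀ T : ℝ, 0 < T →
    (∃ S : Finset ℝ, ∀ t ∈ Ioo 0 T, t ∉ S → DifferentiableAt ℝ j t ∧ ContinuousAt (deriv j) t) ∧
    (∀ t ∈ Ico 0 T, ∃ l : ℝ, Tendsto (deriv j) (𝓝[>] t) (𝓝 l)) ∧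
    (∀ t ∈ Ioc 0 T, ∃ l : ℝ, Tendsto (deriv j) (𝓝[<] t) (𝓝 l))

/-- `û₀(z) = ∫₀¹ e^{z x} u₀(x) dx`. -/
def uHat (u₀ : ℝ → ℝ) (z : ℂ) : ℂ :=
  ∫ x in (0 : ℝ)..1, Complex.exp (z * x) * (u₀ x : ℂ)

/-- `ĵ(z, t) = ∫₀ᵗ e^{z s} j(s) ds`. -/
def jHat (j : ℝ → ℝ) (z : ℂ) (t : ℝ) : ℂ :=
  ∫ s in (0 : ℝ)..t, Complex.exp (z * s) * (j s : ℂ)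

/-- `Δ(z) = e^{-iz}(1 + iz) - e^{iz}(1 - iz)`. -/
def Delta (z : ℂ) : ℂ :=
  Complex.exp (-(Complex.I * z)) * (1 + Complex.I * z)
    - Complex.exp (Complex.I * z) * (1 - Complex.I * z)

/-- `μ₀(z) = (iz + 1) e^{-iz} û₀(iz) + (iz - 1) e^{iz} û₀(-iz) + 2iz ĵ(z², t)`. -/
def mu0 (u₀ j : ℝ → ℝ) (t : ℝ) (z : ℂ) : ℂ :=
  (Complex.I * z + 1) * Complex.exp (-(Complex.I * z)) * uHat u₀ (Complex.I * z)
    + (Complex.I * z - 1) * Complex.exp (Complex.I * z) * uHat u₀ (-(Complex.I * z))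
    + 2 * Complex.I * z * jHat j (z ^ 2) t

/-- `μ₁(z) = μ₀(z) - Δ(z) û₀(-iz)`. -/
def mu1 (u₀ j : ℝ → ℝ) (t : ℝ) (z : ℂ) : ℂ :=
  mu0 u₀ j t z - Delta z * uHat u₀ (-(Complex.I * z))

/-- The elementary solution `e^{izx - z²t}` of the heat equation. -/
def elem (x t : ℝ) (z : ℂ) : ℂ :=
  Complex.exp (Complex.I * z * x - z ^ 2 * t)

/-- Integrand on the real line. -/
def integrandReal (u₀ : ℝ → ℝ) (x t : ℝ) (z : ℂ) : ℂ :=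
  elem x t z * uHat u₀ (-(Complex.I * z))

/-- Integrand on `∂D₊`. -/
def integrandPlus (u₀ j : ℝ → ℝ) (x t : ℝ) (z : ℂ) : ℂ :=
  elem x t z / Delta z * mu0 u₀ j t z

/-- Integrand on `∂D₋`. -/
def integrandMinus (u₀ j : ℝ → ℝ) (x t : ℝ) (z : ℂ) : ℂ :=
  elem x t z / Delta z * mu1 u₀ j t z

/-- Integral of `F` along the ray `{a + r e^{iθ} : r > 0}`, directed from `a` to infinity. -/
def rayIntegral (F : ℂ → ℂ) (a : ℂ) (θ : ℝ) : ℂ :=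
  ∫ r in Ioi (0 : ℝ), F (a + r * Complex.exp (θ * Complex.I)) * Complex.exp (θ * Complex.I)

/-- Absolute convergence of the integral of `F` along the ray `{a + r e^{iθ} : r > 0}`. -/
def RayIntegrable (F : ℂ → ℂ) (a : ℂ) (θ : ℝ) : Prop :=
  IntegrableOn (fun r : ℝ => F (a + r * Complex.exp (θ * Complex.I))) (Ioi 0)

/-- Integral over the boundary of the sector `{a + w : α ≤ arg w ≤ β}`, oriented with the sector on
its left: in along the ray of direction `β`, out along the ray of direction `α`. -/
def sectorBoundaryIntegral (F : ℂ → ℂ) (a : ℂ) (α β : ℝ) : ℂ :=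
  rayIntegral F a α - rayIntegral F a β

/-- Integral over `∂D₊`, `D₊ = {w + iε : π/4 ≤ arg w ≤ 3π/4}`. -/
def integralDPlus (ε : ℝ) (F : ℂ → ℂ) : ℂ :=
  sectorBoundaryIntegral F (ε * Complex.I) (Real.pi / 4) (3 * Real.pi / 4)

/-- Integral over `∂D₋`, `D₋ = {w - iε : 5π/4 ≤ arg w ≤ 7π/4}`. -/
def integralDMinus (ε : ℝ) (F : ℂ → ℂ) : ℂ :=
  sectorBoundaryIntegral F (-(ε * Complex.I)) (5 * Real.pi / 4) (7 * Real.pi / 4)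

/-- All contour integrals of the representation at `(x, t)` converge absolutely. -/
def RepresentationConverges (u₀ j : ℝ → ℝ) (ε x t : ℝ) : Prop :=
  Integrable (fun l : ℝ => integrandReal u₀ x t l) ∧
  RayIntegrable (integrandPlus u₀ j x t) (ε * Complex.I) (Real.pi / 4) ∧
  RayIntegrable (integrandPlus u₀ j x t) (ε * Complex.I) (3 * Real.pi / 4) ∧
  RayIntegrable (integrandMinus u₀ j x t) (-(ε * Complex.I)) (5 * Real.pi / 4) ∧
  RayIntegrable (integrandMinus u₀ j x t) (-(ε * Complex.I)) (7 * Real.pi / 4)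

/-- The integral representation
`(2π)⁻¹ (∫_ℝ e^{iλx-λ²t} û₀(-iλ) dλ - ∫_{∂D₊} e^{iλx-λ²t} μ₀/Δ dλ - ∫_{∂D₋} e^{iλx-λ²t} μ₁/Δ dλ)`
of the solution. -/
def representation (u₀ j : ℝ → ℝ) (ε x t : ℝ) : ℂ :=
  1 / (2 * (Real.pi : ℂ)) *
    ((∫ l : ℝ, integrandReal u₀ x t l)
      - integralDPlus ε (integrandPlus u₀ j x t)
      - integralDMinus ε (integrandMinus u₀ j x t))

/-- `u` is the function on `[0, 1] × (0, ∞)` given by the integral representation: at interior points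
`0 < x < 1` the contour integrals converge absolutely and give `u x t` (for every contour shift `ε`
that is small enough for the factor `e^{-λ²t}`, which grows like `e^{√2 ε t |λ|}` on the shifted
rays, to be controlled by the decay of the other factors), and the values at `x = 0` and `x = 1` are
the limits of the interior ones. These conditions determine `u` on `[0, 1] × (0, ∞)`. -/
def IsRepresentedSolution (u₀ j : ℝ → ℝ) (u : ℝ → ℝ → ℂ) : Prop :=
  ∀ t : ℝ, 0 < t →
    ContinuousOn (fun x => u x t) (Icc 0 1) ∧
    ∀ x ∈ Ioo (0 : ℝ) 1, ∀ ε : ℝ, 0 < ε → 2 * ε * t < x → 2 * ε * t < 1 - x →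
      RepresentationConverges u₀ j ε x t ∧ u x t = representation u₀ j ε x t

end SingleParticle

end

noncomputable section

namespace SingleParticle

/-! After the reflection z ↦ -z, which carries ∂D₋ to ∂D₊ and x to 1 - x, both contour integrands
have the form `kern`: e^{izy}(e^{-z²t} M(z) + N(z) `duhamel` j t z) with y = x or y = 1 - x. Here M
depends on u₀ only, N is universal, and both are holomorphic in the upper half-plane and bounded on
every Im z ≥ a > 0. This rests on the zeros of Δ being real and on |Δ(z)| ≥ c|z|e^{Im z}
(`Delta_ne_zero`, `exists_le_norm_Delta`).

Such a kernel decays quadratically in the two wedges between the rays of ∂D₊ and the horizontal line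
Im z = ε, provided 2εt < y (`exists_norm_kern_sector_le`). Hence the contour opens up to that line
and then moves to Im z = 1 (`integralDPlus_kern`). The resulting `lineSolution` does not involve ε,
makes sense for all x in [0, 1], and is continuous there because the bound on the line is uniform in
y ≥ 0.

For t ↓ 0 the data are split linearly as (u₀, j) = u₀(1)·(x, 0) + (w, 0) + (0, j), where w = u₀ -
u₀(1)x vanishes at both ends. The flux part tends to zero uniformly, and only the boundedness of j
enters; this is why no compatibility at x = 1 is needed (`exists_norm_lineSolution_flux_le`). For w
the transforms decay like |z|⁻², so e^{-z²t} may be replaced by 1 uniformly in x. The real integral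
then gives w(x) by Fourier inversion, and the other two vanish on pushing the line to +i∞
(`exists_norm_lineSolution_sub_le`). The function x satisfies both homogeneous boundary conditions
and is stationary. Its coefficients are rational, and the three integrands add up to an odd entire
part plus 2ix e^{-z²t}/z, whose integral over Im z = 1 supplies the factor that tends to one
(`lineSolution_id`, `tendsto_integral_gaussian_div`). -/

/-! ### Contour deformation: horizontal lines and rays -/

/-- **Shifting a horizontal line of integration.** -/
lemma integral_horizontal_line_eq {f : ℂ → ℂ} {a b : ℝ} (hab : a ≤ b) {g : ℝ → ℝ}
    (hd : ∀ z : ℂ, z.im ∈ Icc a b → DifferentiableAt ℂ f z)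
    (hfg : ∀ x y : ℝ, y ∈ Icc a b → ‖f (x + y * Complex.I)‖ ≤ g x)
    (hg : Integrable g) (htop : Tendsto g atTop (𝓝 0)) (hbot : Tendsto g atBot (𝓝 0)) :
    (∀ y ∈ Icc a b, Integrable fun x : ℝ => f (x + y * Complex.I)) ∧
      ∫ x : ℝ, f (x + a * Complex.I) = ∫ x : ℝ, f (x + b * Complex.I) := by
  have hint : ∀ y ∈ Icc a b, Integrable fun x : ℝ => f (x + y * Complex.I) := by
    intro y hy
    refine hg.mono' (Continuous.aestronglyMeasurable ?_) (ae_of_all _ fun x => hfg x y hy)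
    refine continuous_iff_continuousAt.2 fun x => ?_
    refine ContinuousAt.comp (f := fun x : ℝ => (x + y * Complex.I : ℂ)) ?_ (by fun_prop)
    exact (hd _ (by simpa using hy)).continuousAt
  refine ⟨hint, ?_⟩
  have hvert : ∀ l : Filter ℝ, Tendsto g l (𝓝 0) →
      Tendsto (fun x : ℝ => ∫ y in a..b, f (x + y * Complex.I)) l (𝓝 0) := by
    intro l hl
    have h0 : Tendsto (fun x => g x * |b - a|) l (𝓝 0) := by simpa using hl.mul_const |b - a|
    refine squeeze_zero_norm (fun x => ?_) h0
    refine intervalIntegral.norm_integral_le_of_norm_le_const fun y hy => hfg x y ?_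
    rw [uIoc_of_le hab] at hy
    exact ⟨hy.1.le, hy.2⟩
  have hA := intervalIntegral_tendsto_integral (hint a ⟨le_rfl, hab⟩) tendsto_neg_atTop_atBot
    tendsto_id
  have hB := intervalIntegral_tendsto_integral (hint b ⟨hab, le_rfl⟩) tendsto_neg_atTop_atBot
    tendsto_id
  have hR := (hvert _ htop).const_mul Complex.I
  have hL := ((hvert _ hbot).comp tendsto_neg_atTop_atBot).const_mul Complex.I
  have key := ((hA.sub hB).add hR).sub hL
  have hzero : ∀ R : ℝ, (∫ x in -R..id R, f (x + a * Complex.I))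
      - (∫ x in -R..id R, f (x + b * Complex.I))
      + Complex.I * (∫ y in a..b, f (R + y * Complex.I))
      - Complex.I * ((fun x : ℝ => ∫ y in a..b, f (x + y * Complex.I)) ∘ Neg.neg) R = 0 := by
    intro R
    have := Complex.integral_boundary_rect_eq_zero_of_differentiableOn f (-R + a * Complex.I)
      (R + b * Complex.I) (fun z hz => by
        refine (hd z ?_).differentiableWithinAt
        have := hz.2
        simpa [uIcc_of_le hab] using this)
    simpa using this
  have := tendsto_nhds_unique (key.congr hzero) tendsto_const_nhds
  simpa [sub_eq_zero] using this

lemma tendsto_const_div_one_add_sq_atTop (C : ℝ) :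
    Tendsto (fun x : ℝ => C / (1 + x ^ 2)) atTop (𝓝 0) :=
  Tendsto.div_atTop tendsto_const_nhds
    (tendsto_atTop_add_const_left _ _ (tendsto_pow_atTop two_ne_zero))

lemma tendsto_const_div_one_add_sq_atBot (C : ℝ) :
    Tendsto (fun x : ℝ => C / (1 + x ^ 2)) atBot (𝓝 0) := by
  have := (tendsto_const_div_one_add_sq_atTop C).comp tendsto_neg_atBot_atTop
  refine this.congr fun x => by simp

lemma integrable_const_div_one_add_sq (C : ℝ) : Integrable fun x : ℝ => C / (1 + x ^ 2) := by
  simpa [div_eq_mul_inv] using integrable_inv_one_add_sq.const_mul C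

/-- Shifting a horizontal line of integration, for integrands with quadratic decay. -/
lemma integral_horizontal_line_eq_of_decay {f : ℂ → ℂ} {a b C : ℝ} (hab : a ≤ b)
    (hd : ∀ z : ℂ, z.im ∈ Icc a b → DifferentiableAt ℂ f z)
    (hf : ∀ x y : ℝ, y ∈ Icc a b → ‖f (x + y * Complex.I)‖ ≤ C / (1 + x ^ 2)) :
    (∀ y ∈ Icc a b, Integrable fun x : ℝ => f (x + y * Complex.I)) ∧
      ∫ x : ℝ, f (x + a * Complex.I) = ∫ x : ℝ, f (x + b * Complex.I) :=
  integral_horizontal_line_eq hab hd hf (integrable_const_div_one_add_sq C)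
    (tendsto_const_div_one_add_sq_atTop C) (tendsto_const_div_one_add_sq_atBot C)

lemma range_exp_image : Real.exp '' univ = Ioi 0 := by
  rw [image_univ, Real.range_exp]

lemma integral_Ioi_eq_integral_comp_exp (f : ℝ → ℂ) :
    ∫ r in Ioi (0 : ℝ), f r = ∫ x : ℝ, Real.exp x * f (Real.exp x) := by
  have := integral_image_eq_integral_abs_deriv_smul MeasurableSet.univ
    (fun x _ => (Real.hasDerivAt_exp x).hasDerivWithinAt) Real.exp_injective.injOn f
  rw [range_exp_image] at this
  rw [this]
  simp [abs_of_pos (Real.exp_pos _)]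

lemma integrableOn_Ioi_iff_integrable_comp_exp {f : ℝ → ℝ} :
    IntegrableOn f (Ioi 0) ↔ Integrable fun x : ℝ => Real.exp x * f (Real.exp x) := by
  have := integrableOn_image_iff_integrableOn_abs_deriv_smul MeasurableSet.univ
    (fun x _ => (Real.hasDerivAt_exp x).hasDerivWithinAt) Real.exp_injective.injOn f
  rw [range_exp_image] at this
  rw [this]
  simp [abs_of_pos (Real.exp_pos _), integrableOn_univ]

lemma continuous_ray {F : ℂ → ℂ} {a : ℂ} {θ : ℝ}
    (hd : ∀ r : ℝ, 0 < r → DifferentiableAt ℂ F (a + r * Complex.exp (θ * Complex.I))) :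
    ContinuousOn (fun r : ℝ => F (a + r * Complex.exp (θ * Complex.I))) (Ioi 0) := by
  intro r hr
  refine ContinuousAt.continuousWithinAt ?_
  exact ContinuousAt.comp (f := fun r : ℝ => a + r * Complex.exp (θ * Complex.I))
    (hd r hr).continuousAt (by fun_prop)

/-- Absolute convergence along a ray on which the integrand decays quadratically. -/
lemma rayIntegrable_of_decay {F : ℂ → ℂ} {a : ℂ} {θ C : ℝ}
    (hd : ∀ r : ℝ, 0 < r → DifferentiableAt ℂ F (a + r * Complex.exp (θ * Complex.I)))
    (hF : ∀ r : ℝ, 0 < r → ‖F (a + r * Complex.exp (θ * Complex.I))‖ ≤ C / (1 + r ^ 2)) :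
    RayIntegrable F a θ := by
  refine Integrable.mono' (integrable_const_div_one_add_sq C).integrableOn
    ((continuous_ray hd).aestronglyMeasurable measurableSet_Ioi) ?_
  exact (ae_restrict_iff' measurableSet_Ioi).2 (ae_of_all _ fun r hr => hF r hr)

/-- **Rotating a ray of integration.** -/
lemma rayIntegral_eq_of_decay {F : ℂ → ℂ} {a : ℂ} {α β C : ℝ} (hαβ : α ≤ β)
    (hd : ∀ θ ∈ Icc α β, ∀ r : ℝ, 0 < r →
      DifferentiableAt ℂ F (a + r * Complex.exp (θ * Complex.I)))
    (hF : ∀ θ ∈ Icc α β, ∀ r : ℝ, 0 < r →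
      ‖F (a + r * Complex.exp (θ * Complex.I))‖ ≤ C / (1 + r ^ 2)) :
    rayIntegral F a α = rayIntegral F a β := by
  -- The map z ↦ a + e^z sends the strip α ≤ Im z ≤ β onto the sector without its vertex, so
  -- rotating a ray becomes shifting a horizontal line. The Jacobian e^z makes the integrand small
  -- at both ends of the strip.
  set G : ℂ → ℂ := fun z => F (a + Complex.exp z) * Complex.exp z with hG
  have hexp : ∀ x y : ℝ, Complex.exp (x + y * Complex.I)
      = (Real.exp x : ℝ) * Complex.exp (y * Complex.I) := by
    intro x y; rw [Complex.exp_add, Complex.ofReal_exp]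
  have hray : ∀ θ : ℝ, rayIntegral F a θ = ∫ x : ℝ, G (x + θ * Complex.I) := by
    intro θ
    rw [rayIntegral, integral_Ioi_eq_integral_comp_exp]
    refine integral_congr_ae (ae_of_all _ fun x => ?_)
    simp only [hG, hexp]
    ring
  rw [hray, hray]
  refine (integral_horizontal_line_eq (g := fun x => Real.exp x * (C / (1 + Real.exp x ^ 2))) hαβ
    ?_ ?_ ?_ ?_ ?_).2
  · intro z hz
    have : Complex.exp z = (Real.exp z.re : ℝ) * Complex.exp (z.im * Complex.I) := by
      rw [← hexp, Complex.re_add_im]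
    have h1 := hd z.im hz (Real.exp z.re) (Real.exp_pos _)
    rw [← this] at h1
    refine DifferentiableAt.mul (DifferentiableAt.comp (g := F) (f := fun z => a + Complex.exp z)
      z h1 (by fun_prop)) (by fun_prop)
  · intro x y hy
    simp only [hG, norm_mul, Complex.norm_exp]
    rw [hexp, mul_comm]
    simpa using mul_le_mul_of_nonneg_left (hF y hy _ (Real.exp_pos x)) (Real.exp_pos x).le
  · exact integrableOn_Ioi_iff_integrable_comp_exp (f := fun r => C / (1 + r ^ 2)) |>.1
      (integrable_const_div_one_add_sq C).integrableOn
  · have h : Tendsto (fun r : ℝ => r * (C / (1 + r ^ 2))) atTop (𝓝 0) := by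
      have h1 : Tendsto (fun r : ℝ => |C| / r) atTop (𝓝 0) :=
        Tendsto.div_atTop tendsto_const_nhds tendsto_id
      refine squeeze_zero_norm' ?_ h1
      filter_upwards [eventually_gt_atTop 0] with r hr
      rw [norm_mul, norm_div, Real.norm_of_nonneg hr.le, Real.norm_eq_abs,
        Real.norm_of_nonneg (by positivity), ← mul_div_assoc, div_le_div_iff₀ (by positivity) hr]
      nlinarith [abs_nonneg C]
    exact h.comp Real.tendsto_exp_atTop
  · have h : Tendsto (fun r : ℝ => r * (C / (1 + r ^ 2))) (𝓝 0) (𝓝 0) := by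
      have : Continuous fun r : ℝ => r * (C / (1 + r ^ 2)) := by
        refine continuous_id.mul (continuous_const.div (by fun_prop) fun r => by positivity)
      simpa using this.tendsto 0
    exact h.comp Real.tendsto_exp_atBot

/-! ### Entire transforms; zeros and lower bound of Δ -/

/-- The Laplace-type transform of an integrable function on a bounded interval is entire. -/
lemma differentiable_integral_exp_mul {f : ℝ → ℂ} {a b : ℝ} (hf : IntervalIntegrable f volume a b) :
    Differentiable ℂ fun z : ℂ => ∫ x in a..b, Complex.exp (z * x) * f x := by
  intro z₀
  set R := |a| + |b| with hR
  have hxR : ∀ x ∈ uIoc a b, |x| ≤ R := by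
    intro x hx
    have := uIoc_subset_uIcc hx
    rcases le_total a b with h | h
    · rw [uIcc_of_le h] at this
      rw [abs_le]; constructor <;>
        [linarith [neg_abs_le a, this.1, abs_nonneg b]; linarith [le_abs_self b, this.2, abs_nonneg a]]
    · rw [uIcc_of_ge h] at this
      rw [abs_le]; constructor <;>
        [linarith [neg_abs_le b, this.1, abs_nonneg a]; linarith [le_abs_self a, this.2, abs_nonneg b]]
  have hm : AEStronglyMeasurable f (volume.restrict (uIoc a b)) := hf.def'.aestronglyMeasurable
  refine (intervalIntegral.hasDerivAt_integral_of_dominated_loc_of_deriv_le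
    (F := fun z x => Complex.exp (z * x) * f x) (F' := fun z x => x * Complex.exp (z * x) * f x)
    (bound := fun x => R * Real.exp ((‖z₀‖ + 1) * R) * ‖f x‖)
    (Metric.ball_mem_nhds z₀ one_pos) ?_ ?_ ?_ ?_ ?_ ?_).2.differentiableAt
  · exact Eventually.of_forall fun z => (Continuous.aestronglyMeasurable (by fun_prop)).mul hm
  · exact hf.continuousOn_mul (Continuous.continuousOn (by fun_prop))
  · exact (Continuous.aestronglyMeasurable (by fun_prop)).mul hm
  · refine ae_of_all _ fun x hx z hz => ?_
    have hz' : ‖z‖ ≤ ‖z₀‖ + 1 := by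
      have := norm_le_norm_add_norm_sub' z z₀
      rw [mem_ball_iff_norm] at hz
      linarith
    have hx' := hxR x hx
    rw [norm_mul, norm_mul, Complex.norm_real, Complex.norm_exp, Real.norm_eq_abs]
    gcongr
    refine (Complex.re_le_norm _).trans ?_
    rw [norm_mul, Complex.norm_real, Real.norm_eq_abs]
    gcongr
  · exact hf.norm.const_mul _
  · refine ae_of_all _ fun x hx z hz => ?_
    have h : HasDerivAt (fun z : ℂ => Complex.exp (z * x)) (Complex.exp (z * x) * (1 * x)) z :=
      ((hasDerivAt_id z).mul_const (x : ℂ)).cexp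
    have h' := h.mul_const (f x)
    rwa [show Complex.exp (z * x) * (1 * x) * f x = x * Complex.exp (z * x) * f x by ring] at h'

/-- This form exhibits the zeros of Δ as the solutions of z cos z = sin z. -/
lemma Delta_eq (z : ℂ) : Delta z = 2 * Complex.I * (z * Complex.cos z - Complex.sin z) := by
  have h1 : Complex.exp (Complex.I * z) = Complex.cos z + Complex.sin z * Complex.I := by
    rw [mul_comm, Complex.exp_mul_I]
  have h2 : Complex.exp (-(Complex.I * z)) = Complex.cos z - Complex.sin z * Complex.I := by
    rw [show -(Complex.I * z) = (-z) * Complex.I by ring, Complex.exp_mul_I, Complex.cos_neg,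
      Complex.sin_neg]
    ring
  rw [Delta, h1, h2]
  ring

lemma Delta_neg (z : ℂ) : Delta (-z) = -Delta z := by
  rw [Delta_eq, Delta_eq, Complex.cos_neg, Complex.sin_neg]
  ring

lemma differentiable_Delta : Differentiable ℂ Delta := by
  unfold Delta
  fun_prop

lemma sinh_lt_mul_cosh {b : ℝ} (hb : 0 < b) : Real.sinh b < b * Real.cosh b := by
  have hd : ∀ x : ℝ, HasDerivAt (fun x => x * Real.cosh x - Real.sinh x) (x * Real.sinh x) x := by
    intro x
    have := ((hasDerivAt_id x).mul (Real.hasDerivAt_cosh x)).sub (Real.hasDerivAt_sinh x)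
    simp only [id, one_mul, add_sub_cancel_left] at this
    exact this
  have hmono : StrictMonoOn (fun x => x * Real.cosh x - Real.sinh x) (Ici 0) := by
    refine strictMonoOn_of_deriv_pos (convex_Ici 0) (by fun_prop) fun x hx => ?_
    rw [interior_Ici] at hx
    rw [(hd x).deriv]
    exact mul_pos hx (Real.sinh_pos_iff.2 hx)
  have := hmono (mem_Ici.2 le_rfl) (mem_Ici.2 hb.le) hb
  simp at this
  linarith

/-- All zeros of `Δ` are real. -/
lemma Delta_ne_zero {z : ℂ} (hz : 0 < z.im) : Delta z ≠ 0 := by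
  intro h
  rw [Delta_eq] at h
  have h0 : z * Complex.cos z = Complex.sin z := by
    have := (mul_eq_zero.1 h).resolve_left (by simp)
    exact sub_eq_zero.1 this
  obtain ⟨a, b⟩ := z
  rw [Complex.cos_eq ⟨a, b⟩, Complex.sin_eq ⟨a, b⟩] at h0
  simp only at hz h0
  have hre := congrArg Complex.re h0
  have him := congrArg Complex.im h0
  simp only [← Complex.ofReal_cos, ← Complex.ofReal_sin, ← Complex.ofReal_cosh,
    ← Complex.ofReal_sinh, ← Complex.ofReal_mul, Complex.mul_re, Complex.mul_im, Complex.sub_re,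
    Complex.sub_im, Complex.add_re, Complex.add_im, Complex.ofReal_re, Complex.ofReal_im,
    Complex.I_re, Complex.I_im] at hre him
  have hsc := Real.sin_sq_add_cos_sq a
  have hch := Real.cosh_sq b
  have hs := Real.self_le_sinh_iff.2 hz.le
  have hc : 1 < Real.cosh b := Real.one_lt_cosh.2 hz.ne'
  -- N = |cos z|². Multiplying z cos z = sin z by the conjugate of cos z separates into aN = sin a
  -- cos a and bN = sinh b cosh b. The second forces N > 1, then the first forces a = 0, and on the
  -- imaginary axis b cosh b = sinh b is impossible.
  set N := Real.cos a ^ 2 + Real.sinh b ^ 2 with hN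
  have haN : a * N = Real.sin a * Real.cos a := by
    have e1 : N = Real.cos a ^ 2 * Real.cosh b ^ 2 + Real.sin a ^ 2 * Real.sinh b ^ 2 := by
      rw [hN, hch]; linear_combination (-Real.sinh b ^ 2) * hsc
    rw [e1]
    linear_combination (Real.cos a * Real.cosh b) * hre - (Real.sin a * Real.sinh b) * him
      + Real.sin a * Real.cos a * hch
  have hbN : b * N = Real.sinh b * Real.cosh b := by
    have e1 : N = Real.cos a ^ 2 * Real.cosh b ^ 2 + Real.sin a ^ 2 * Real.sinh b ^ 2 := by
      rw [hN, hch]; linear_combination (-Real.sinh b ^ 2) * hsc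
    rw [e1]
    linear_combination (Real.sin a * Real.sinh b) * hre + (Real.cos a * Real.cosh b) * him
      + Real.sinh b * Real.cosh b * hsc
  have hN1 : 1 < N := by
    have h1 : b * 1 < b * N := by nlinarith
    exact lt_of_mul_lt_mul_left h1 hz.le
  have ha : a = 0 := by
    by_contra ha
    have h1 : |a| * N = |Real.sin a| * |Real.cos a| := by
      rw [← abs_mul, ← haN, abs_mul, abs_of_pos (by linarith : 0 < N)]
    have h2 := Real.abs_sin_lt_abs ha
    have h3 := Real.abs_cos_le_one a
    nlinarith [abs_nonneg (Real.sin a), abs_nonneg (Real.cos a), abs_pos.2 ha]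
  have h4 := sinh_lt_mul_cosh hz
  rw [ha] at hN
  simp at hN
  have h5 : N = Real.cosh b ^ 2 := by rw [hN, hch]; ring
  rw [h5] at hbN
  nlinarith

lemma norm_exp_I_mul (z : ℂ) : ‖Complex.exp (Complex.I * z)‖ = Real.exp (-z.im) := by
  rw [Complex.norm_exp]; simp

lemma norm_exp_neg_I_mul (z : ℂ) : ‖Complex.exp (-(Complex.I * z))‖ = Real.exp z.im := by
  rw [Complex.norm_exp]; simp

/-- Lower bound for `Δ` away from the real axis. -/
lemma exists_le_norm_Delta {ε : ℝ} (hε : 0 < ε) :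
    ∃ c : ℝ, 0 < c ∧ ∀ z : ℂ, ε ≤ z.im → c * ‖z‖ * Real.exp z.im ≤ ‖Delta z‖ := by
  set q := Real.exp (-(2 * ε)) with hq
  have hq0 : 0 < q := Real.exp_pos _
  have hq1 : q < 1 := by rw [hq]; exact Real.exp_lt_one_iff.2 (by linarith)
  -- For Im z ≥ ε the term with e^{iz} carries at most the fraction q of the exponential weight of
  -- the other one. Beyond radius R the difference (1 - q)|z| - (1 + q) exceeds (1 - q)|z|/2;
  -- inside, compactness and the absence of zeros give the bound.
  set R := 2 * (1 + q) / (1 - q) with hR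
  set K : Set ℂ := {z | ε ≤ z.im} ∩ Metric.closedBall 0 R with hK
  have hKc : IsCompact K :=
    (isCompact_closedBall 0 R).inter_left (isClosed_le continuous_const Complex.continuous_im)
  have hpos : ∀ z : ℂ, ε ≤ z.im → 0 < ‖z‖ := by
    intro z hz
    have := (hz.trans (le_abs_self _)).trans (Complex.abs_im_le_norm z)
    linarith
  obtain ⟨m, hm0, hm⟩ := hKc.exists_forall_le' (f := fun z => ‖Delta z‖ / (‖z‖ * Real.exp z.im))
    (a := 0) (by
      refine ContinuousOn.div (differentiable_Delta.continuous.norm.continuousOn)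
        (Continuous.continuousOn (by fun_prop)) fun z hz => ?_
      exact (mul_pos (hpos z hz.1) (Real.exp_pos _)).ne')
    (fun z hz => div_pos (norm_pos_iff.2 (Delta_ne_zero (hε.trans_le hz.1)))
      (mul_pos (hpos z hz.1) (Real.exp_pos _)))
  refine ⟨min m ((1 - q) / 2), lt_min hm0 (by linarith), fun z hz => ?_⟩
  have hz0 := hpos z hz
  have hE := Real.exp_pos z.im
  rcases le_or_gt ‖z‖ R with hzR | hzR
  · have := hm z ⟨hz, by simpa using hzR⟩
    rw [le_div_iff₀ (mul_pos hz0 hE), ← mul_assoc] at this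
    refine le_trans ?_ this
    gcongr
    exact min_le_left _ _
  · have h1 : ‖z‖ - 1 ≤ ‖1 + Complex.I * z‖ := by
      have := norm_sub_norm_le (Complex.I * z) (-1)
      simp only [norm_mul, Complex.norm_I, one_mul, norm_neg, norm_one, sub_neg_eq_add] at this
      rwa [add_comm (1 : ℂ)]
    have h2 : ‖1 - Complex.I * z‖ ≤ 1 + ‖z‖ := by
      have := norm_sub_le 1 (Complex.I * z)
      simpa using this
    have h3 : Real.exp (-z.im) ≤ q * Real.exp z.im := by
      rw [hq, ← Real.exp_add]
      exact Real.exp_le_exp.2 (by linarith)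
    have h4 : ‖Delta z‖ ≥ Real.exp z.im * ‖1 + Complex.I * z‖
        - Real.exp (-z.im) * ‖1 - Complex.I * z‖ := by
      have := norm_sub_norm_le (Complex.exp (-(Complex.I * z)) * (1 + Complex.I * z))
        (Complex.exp (Complex.I * z) * (1 - Complex.I * z))
      rw [norm_mul, norm_mul, norm_exp_I_mul, norm_exp_neg_I_mul] at this
      exact this
    have h5 : 2 * (1 + q) < (1 - q) * ‖z‖ := by
      rw [hR, div_lt_iff₀ (by linarith)] at hzR
      linarith
    calc min m ((1 - q) / 2) * ‖z‖ * Real.exp z.im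
        ≤ (1 - q) / 2 * ‖z‖ * Real.exp z.im := by gcongr; exact min_le_right _ _
      _ ≤ Real.exp z.im * (‖z‖ - 1) - q * Real.exp z.im * (1 + ‖z‖) := by nlinarith
      _ ≤ Real.exp z.im * ‖1 + Complex.I * z‖ - Real.exp (-z.im) * ‖1 - Complex.I * z‖ := by
          gcongr
      _ ≤ ‖Delta z‖ := h4

/-! ### Coefficient functions and decay of the transform of the initial data -/

/-- The factor of `e^{izx - z²t}` in the initial-data part of the integrand on `∂D₊`. -/
def coefPlus (u : ℝ → ℝ) (z : ℂ) : ℂ :=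
  ((Complex.I * z + 1) * Complex.exp (-(Complex.I * z)) * uHat u (Complex.I * z)
    + (Complex.I * z - 1) * Complex.exp (Complex.I * z) * uHat u (-(Complex.I * z))) / Delta z

/-- The factor of `e^{iz(1-x) - z²t}` in the initial-data part of the integrand on `∂D₋`, reflected
to the upper half-plane. -/
def coefMinus (u : ℝ → ℝ) (z : ℂ) : ℂ :=
  (1 - Complex.I * z) * (uHat u (Complex.I * z) - uHat u (-(Complex.I * z))) / Delta z

/-- The factor of `ĵ` in the integrand on `∂D₊`. -/
def fluxPlus (z : ℂ) : ℂ := 2 * Complex.I * z / Delta z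

/-- The factor of `ĵ` in the integrand on `∂D₋`, reflected to the upper half-plane. -/
def fluxMinus (z : ℂ) : ℂ := 2 * Complex.I * z * Complex.exp (-(Complex.I * z)) / Delta z

/-- The lower bound c|z|e^{Im z} for Δ cancels the linear factor and the exponential growth of each
numerator. Since û(-iz) may grow like e^{Im z}, its hypothesis carries the compensating e^{iz}. The
constant is independent of u and B, so B can later be a constant or of size |z|⁻². -/
lemma exists_norm_coef_le {ε : ℝ} (hε : 0 < ε) :
    ∃ C : ℝ, 0 < C ∧ ∀ z : ℂ, ε ≤ z.im →
      ‖fluxPlus z‖ ≤ C ∧ ‖fluxMinus z‖ ≤ C ∧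
      ∀ (u : ℝ → ℝ) (B : ℝ), ‖uHat u (Complex.I * z)‖ ≤ B →
        ‖Complex.exp (Complex.I * z) * uHat u (-(Complex.I * z))‖ ≤ B →
        ‖coefPlus u z‖ ≤ C * B ∧ ‖coefMinus u z‖ ≤ C * B := by
  obtain ⟨c, hc, hΔ⟩ := exists_le_norm_Delta hε
  -- Chosen so that 1 + |z| ≤ k|z| whenever |z| ≥ ε.
  set k := 1 + 1 / ε with hk
  have hk1 : 1 ≤ k := by rw [hk]; linarith [one_div_pos.2 hε]
  refine ⟨2 * k / c, by positivity, fun z hz => ?_⟩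
  have hzε : ε ≤ ‖z‖ := (hz.trans (le_abs_self _)).trans (Complex.abs_im_le_norm z)
  have hz0 : 0 < ‖z‖ := hε.trans_le hzε
  have hD := hΔ z hz
  have hD0 : 0 < c * ‖z‖ * Real.exp z.im := by positivity
  have hDp : 0 < ‖Delta z‖ := hD0.trans_le hD
  have hE1 : 1 ≤ Real.exp z.im := Real.one_le_exp (hε.le.trans hz)
  have hkz : 1 + ‖z‖ ≤ k * ‖z‖ := by
    have : 1 ≤ 1 / ε * ‖z‖ := by rw [one_div, inv_mul_eq_div, one_le_div hε]; exact hzε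
    rw [hk]; linarith
  have hp : ‖Complex.I * z + 1‖ ≤ k * ‖z‖ := by
    have := norm_add_le (Complex.I * z) 1
    simp at this; linarith
  have hm : ‖Complex.I * z - 1‖ ≤ k * ‖z‖ := by
    have := norm_sub_le (Complex.I * z) 1
    simp at this; linarith
  have hm' : ‖1 - Complex.I * z‖ ≤ k * ‖z‖ := by rwa [norm_sub_rev]
  have hgen : ∀ X B : ℝ, 0 ≤ B → X ≤ 2 * (k * ‖z‖) * Real.exp z.im * B →
      X / ‖Delta z‖ ≤ 2 * k / c * B := by
    intro X B hB hX
    rw [div_le_iff₀ hDp]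
    calc X ≤ 2 * (k * ‖z‖) * Real.exp z.im * B := hX
      _ = 2 * k / c * B * (c * ‖z‖ * Real.exp z.im) := by field_simp
      _ ≤ _ := by gcongr
  refine ⟨?_, ?_, fun u B hu1 hu2 => ?_⟩
  · rw [fluxPlus, norm_div, ← mul_one (2 * k / c)]
    refine hgen _ 1 zero_le_one ?_
    simp only [norm_mul, Complex.norm_I, Complex.norm_ofNat, mul_one]
    nlinarith [mul_le_mul hk1 hE1 zero_le_one (by linarith)]
  · rw [fluxMinus, norm_div, ← mul_one (2 * k / c)]
    refine hgen _ 1 zero_le_one ?_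
    simp only [norm_mul, Complex.norm_I, Complex.norm_ofNat, mul_one, norm_exp_neg_I_mul]
    gcongr
    nlinarith
  have hB : 0 ≤ B := (norm_nonneg _).trans hu1
  constructor
  · rw [coefPlus, norm_div]
    refine hgen _ B hB ((norm_add_le _ _).trans ?_)
    rw [mul_assoc (Complex.I * z - 1), norm_mul (Complex.I * z - 1), norm_mul, norm_mul,
      norm_exp_neg_I_mul]
    have h1 : ‖Complex.I * z + 1‖ * Real.exp z.im * ‖uHat u (Complex.I * z)‖
        ≤ k * ‖z‖ * Real.exp z.im * B := by gcongr
    have h2 : ‖Complex.I * z - 1‖ * ‖Complex.exp (Complex.I * z) * uHat u (-(Complex.I * z))‖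
        ≤ k * ‖z‖ * Real.exp z.im * B := by
      have : k * ‖z‖ * 1 * B ≤ k * ‖z‖ * Real.exp z.im * B := by gcongr
      refine le_trans ?_ this
      rw [mul_one]
      gcongr
    linarith
  · rw [coefMinus, norm_div]
    refine hgen _ B hB ?_
    have h3 : ‖uHat u (-(Complex.I * z))‖ ≤ Real.exp z.im * B := by
      rw [norm_mul, norm_exp_I_mul, Real.exp_neg, inv_mul_eq_div, div_le_iff₀ (by positivity)] at hu2
      linarith
    have h4 : ‖uHat u (Complex.I * z) - uHat u (-(Complex.I * z))‖ ≤ 2 * Real.exp z.im * B := by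
      refine (norm_sub_le _ _).trans ?_
      nlinarith
    rw [norm_mul]
    calc _ ≤ k * ‖z‖ * (2 * Real.exp z.im * B) := by gcongr
      _ = _ := by ring

/-- Reflecting the interval `[0, 1]`. -/
lemma exp_mul_uHat_neg (u : ℝ → ℝ) (w : ℂ) :
    Complex.exp w * uHat u (-w) = uHat (fun x => u (1 - x)) w := by
  rw [uHat, uHat, ← intervalIntegral.integral_const_mul]
  have := intervalIntegral.integral_comp_sub_left
    (f := fun x : ℝ => Complex.exp (w * ((1 - x : ℝ) : ℂ)) * (u x : ℂ)) (a := 0) (b := 1) 1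
  simp only [sub_sub_cancel, sub_self, sub_zero] at this
  rw [this]
  refine intervalIntegral.integral_congr fun x _ => ?_
  rw [← mul_assoc, ← Complex.exp_add]
  congr 2
  push_cast
  ring

lemma norm_exp_mul_ofReal_le_one {w : ℂ} {x : ℝ} (hw : w.re ≤ 0) (hx : 0 ≤ x) :
    ‖Complex.exp (w * x)‖ ≤ 1 := by
  rw [Complex.norm_exp]
  refine Real.exp_le_one_iff.2 ?_
  simp
  exact mul_nonpos_of_nonpos_of_nonneg hw hx

lemma norm_integral_exp_mul_le {f : ℝ → ℝ} {K : ℝ} (hf : ∀ x ∈ Icc (0 : ℝ) 1, |f x| ≤ K) {w : ℂ}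
    (hw : w.re ≤ 0) : ‖uHat f w‖ ≤ K := by
  have := intervalIntegral.norm_integral_le_of_norm_le_const (a := 0) (b := 1)
    (f := fun x : ℝ => Complex.exp (w * x) * (f x : ℂ)) (C := K) (fun x hx => by
      rw [uIoc_of_le zero_le_one] at hx
      rw [norm_mul, Complex.norm_real, Real.norm_eq_abs]
      calc _ ≤ 1 * |f x| := by gcongr; exact norm_exp_mul_ofReal_le_one hw hx.1.le
        _ ≤ K := by rw [one_mul]; exact hf x ⟨hx.1.le, hx.2⟩)
  simpa [uHat] using this

lemma exists_abs_le_of_continuousOn {f : ℝ → ℝ} (hf : ContinuousOn f (Icc 0 1)) :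
    ∃ K : ℝ, ∀ x ∈ Icc (0 : ℝ) 1, |f x| ≤ K := isCompact_Icc.exists_bound_of_continuousOn hf

lemma exists_norm_uHat_le {f : ℝ → ℝ} (hf : ContinuousOn f (Icc 0 1)) :
    ∃ K : ℝ, ∀ w : ℂ, w.re ≤ 0 → ‖uHat f w‖ ≤ K := by
  obtain ⟨K, hK⟩ := exists_abs_le_of_continuousOn hf
  exact ⟨K, fun w hw => norm_integral_exp_mul_le hK hw⟩

/-- Integration by parts. Each application gains one power of w at the price of boundary values. -/
lemma mul_uHat {f f' : ℝ → ℝ} (hf : ContinuousOn f (Icc 0 1)) (hf' : ContinuousOn f' (Icc 0 1))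
    (hd : ∀ x ∈ Ioo (0 : ℝ) 1, HasDerivAt f (f' x) x) (w : ℂ) :
    w * uHat f w = Complex.exp w * f 1 - f 0 - uHat f' w := by
  have h := intervalIntegral.integral_mul_deriv_eq_deriv_mul_of_hasDerivAt (a := 0) (b := 1)
    (u := fun x : ℝ => (f x : ℂ)) (u' := fun x : ℝ => (f' x : ℂ))
    (v := fun x : ℝ => Complex.exp (w * x)) (v' := fun x : ℝ => w * Complex.exp (w * x))
    (by rw [uIcc_of_le zero_le_one]; exact Complex.continuous_ofReal.comp_continuousOn hf)
    (by fun_prop)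
    (by simpa using fun x h0 h1 => (hd x ⟨h0, h1⟩).ofReal_comp)
    (by
      intro x _
      have h : HasDerivAt (fun x : ℝ => w * (x : ℂ)) (w * 1) x :=
        (Complex.ofRealCLM.hasDerivAt (x := x)).const_mul w
      have h2 := h.cexp
      rwa [mul_one, mul_comm] at h2)
    (ContinuousOn.intervalIntegrable (by
      rw [uIcc_of_le zero_le_one]; exact Complex.continuous_ofReal.comp_continuousOn hf'))
    (Continuous.intervalIntegrable (by fun_prop) _ _)
  rw [uHat, uHat, ← intervalIntegral.integral_const_mul]
  simp only [Complex.ofReal_one, mul_one, Complex.ofReal_zero, mul_zero, Complex.exp_zero] at h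
  rw [mul_comm (Complex.exp w)]
  have e1 : ∀ x : ℝ, w * (Complex.exp (w * x) * (f x : ℂ)) = f x * (w * Complex.exp (w * x)) :=
    fun x => by ring
  have e2 : ∀ x : ℝ, Complex.exp (w * x) * (f' x : ℂ) = f' x * Complex.exp (w * x) :=
    fun x => by ring
  simp only [e1, e2]
  exact h

/-- The transform of a `C²` function vanishing at the end points decays quadratically. -/
lemma exists_norm_uHat_mul_sq_le {f : ℝ → ℝ} (hf : ContDiffOn ℝ 2 f (Icc 0 1)) (h0 : f 0 = 0)
    (h1 : f 1 = 0) : ∃ K : ℝ, ∀ w : ℂ, w.re ≤ 0 → ‖w‖ ^ 2 * ‖uHat f w‖ ≤ K := by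
  have hu : UniqueDiffOn ℝ (Icc (0 : ℝ) 1) := uniqueDiffOn_Icc zero_lt_one
  set f' := derivWithin f (Icc 0 1) with hf'
  set f'' := derivWithin f' (Icc 0 1) with hf''
  have hc1 : ContDiffOn ℝ 1 f' (Icc 0 1) := hf.derivWithin hu (by norm_num)
  have hc2 : ContinuousOn f'' (Icc 0 1) := hc1.continuousOn_derivWithin hu le_rfl
  have hd1 : ∀ x ∈ Ioo (0 : ℝ) 1, HasDerivAt f (f' x) x := fun x hx =>
    ((hf.differentiableOn (by norm_num) x (Ioo_subset_Icc_self hx)).hasDerivWithinAt).hasDerivAt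
      (Icc_mem_nhds hx.1 hx.2)
  have hd2 : ∀ x ∈ Ioo (0 : ℝ) 1, HasDerivAt f' (f'' x) x := fun x hx =>
    ((hc1.differentiableOn (by norm_num) x (Ioo_subset_Icc_self hx)).hasDerivWithinAt).hasDerivAt
      (Icc_mem_nhds hx.1 hx.2)
  obtain ⟨K, hK⟩ := exists_norm_uHat_le hc2
  refine ⟨|f' 1| + |f' 0| + K, fun w hw => ?_⟩
  have e1 := mul_uHat hf.continuousOn hc1.continuousOn hd1 w
  have e2 := mul_uHat hc1.continuousOn hc2 hd2 w
  have e3 : w ^ 2 * uHat f w = -(Complex.exp w * f' 1 - f' 0 - uHat f'' w) := by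
    rw [h0, h1] at e1
    rw [← e2, pow_two, mul_assoc, e1]
    push_cast
    ring
  rw [← norm_pow, ← norm_mul, e3, norm_neg]
  refine (norm_sub_le _ _).trans (add_le_add ((norm_sub_le _ _).trans (add_le_add ?_ ?_)) (hK w hw))
  · rw [norm_mul, Complex.norm_real, Real.norm_eq_abs]
    have := norm_exp_mul_ofReal_le_one hw zero_le_one
    rw [Complex.ofReal_one, mul_one] at this
    nlinarith [abs_nonneg (f' 1)]
  · rw [Complex.norm_real, Real.norm_eq_abs]

lemma differentiable_uHat {u : ℝ → ℝ} (hu : ContinuousOn u (Icc 0 1)) :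
    Differentiable ℂ (uHat u) := by
  refine differentiable_integral_exp_mul (f := fun x => (u x : ℂ)) ?_
  refine ContinuousOn.intervalIntegrable ?_
  rw [uIcc_of_le zero_le_one]
  exact Complex.continuous_ofReal.comp_continuousOn hu

lemma differentiableAt_coefPlus {u : ℝ → ℝ} (hu : ContinuousOn u (Icc 0 1)) {z : ℂ}
    (hz : 0 < z.im) : DifferentiableAt ℂ (coefPlus u) z := by
  have := differentiable_uHat hu
  refine DifferentiableAt.div (Differentiable.differentiableAt ?_) (differentiable_Delta z)
    (Delta_ne_zero hz)
  fun_prop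

lemma differentiableAt_coefMinus {u : ℝ → ℝ} (hu : ContinuousOn u (Icc 0 1)) {z : ℂ}
    (hz : 0 < z.im) : DifferentiableAt ℂ (coefMinus u) z := by
  have := differentiable_uHat hu
  refine DifferentiableAt.div (Differentiable.differentiableAt ?_) (differentiable_Delta z)
    (Delta_ne_zero hz)
  fun_prop

lemma differentiableAt_fluxPlus {z : ℂ} (hz : 0 < z.im) : DifferentiableAt ℂ fluxPlus z :=
  DifferentiableAt.div (by fun_prop) (differentiable_Delta z) (Delta_ne_zero hz)

lemma differentiableAt_fluxMinus {z : ℂ} (hz : 0 < z.im) : DifferentiableAt ℂ fluxMinus z :=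
  DifferentiableAt.div (by fun_prop) (differentiable_Delta z) (Delta_ne_zero hz)

/-! ### Bounds for the boundary data and its Duhamel integral -/

/-- Mean value inequality from the midpoint. It turns the one-sided limits of j' into one-sided
local bounds for j, whose boundedness is not assumed. -/
lemma exists_abs_le_of_abs_deriv_le {j : ℝ → ℝ} {p q D : ℝ} (hpq : p < q)
    (hd : ∀ s ∈ Ioo p q, DifferentiableAt ℝ j s) (hD : ∀ s ∈ Ioo p q, |deriv j s| ≤ D) :
    ∃ K : ℝ, ∀ s ∈ Ioo p q, |j s| ≤ K := by
  have hm : (p + q) / 2 ∈ Ioo p q := ⟨by linarith, by linarith⟩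
  have hD0 : 0 ≤ D := (abs_nonneg _).trans (hD _ hm)
  refine ⟨|j ((p + q) / 2)| + D * (q - p), fun s hs => ?_⟩
  have h := (convex_Ioo p q).norm_image_sub_le_of_norm_deriv_le (𝕜 := ℝ) hd hD hm hs
  have h2 : ‖s - (p + q) / 2‖ ≤ q - p := by
    rw [Real.norm_eq_abs, abs_le]
    constructor <;> linarith [hs.1, hs.2]
  have h3 : |j s| - |j ((p + q) / 2)| ≤ |j s - j ((p + q) / 2)| := abs_sub_abs_le_abs_sub _ _
  rw [Real.norm_eq_abs] at h
  nlinarith [mul_le_mul_of_nonneg_left h2 hD0]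

lemma eventually_abs_le_of_tendsto {f : ℝ → ℝ} {F : Filter ℝ} {l : ℝ} (h : Tendsto f F (𝓝 l)) :
    ∀ᶠ s in F, |f s| ≤ |l| + 1 := by
  have := h.abs.eventually (gt_mem_nhds (lt_add_one |l|))
  exact this.mono fun s hs => hs.le

lemma eventually_notMem_finset (S : Finset ℝ) (t : ℝ) : ∀ᶠ s in 𝓝[≠] t, s ∉ S := by
  have h : ((S.erase t : Finset ℝ) : Set ℝ)ᶜ ∈ 𝓝 t :=
    (S.erase t).finite_toSet.isClosed.isOpen_compl.mem_nhds (by simp)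
  filter_upwards [mem_nhdsWithin_of_mem_nhds h, self_mem_nhdsWithin] with s hs hst hsS
  exact hs (by simpa using ⟨hsS, hst⟩)

/-- A function with piecewise continuous derivative is bounded on bounded intervals. -/
lemma HasPiecewiseContinuousDeriv.exists_abs_le {j : ℝ → ℝ} (hj : HasPiecewiseContinuousDeriv j)
    {T : ℝ} (hT : 0 < T) : ∃ K : ℝ, ∀ s ∈ Icc 0 T, |j s| ≤ K := by
  obtain ⟨⟨S, hS⟩, hr, hl⟩ := hj T hT
  have hright : ∀ t ∈ Ico 0 T, ∃ K : ℝ, ∀ᶠ s in 𝓝[>] t, |j s| ≤ K := by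
    intro t ht
    obtain ⟨l, hl⟩ := hr t ht
    have h1 : ∀ᶠ s in 𝓝[>] t, (s ∈ Ioo 0 T ∧ s ∉ S) ∧ |deriv j s| ≤ |l| + 1 := by
      refine (Eventually.and ?_ ?_).and (eventually_abs_le_of_tendsto hl)
      · filter_upwards [Ioo_mem_nhdsGT ht.2] with s hs
        exact ⟨ht.1.trans_lt hs.1, hs.2⟩
      · exact (eventually_notMem_finset S t).filter_mono (nhdsWithin_mono _ fun s hs => ne_of_gt hs)
    obtain ⟨q, hq, hsub⟩ := (mem_nhdsGT_iff_exists_Ioo_subset).1 h1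
    obtain ⟨K, hK⟩ := exists_abs_le_of_abs_deriv_le hq
      (fun s hs => (hS s (hsub hs).1.1 (hsub hs).1.2).1) (fun s hs => (hsub hs).2)
    exact ⟨K, by filter_upwards [Ioo_mem_nhdsGT hq] with s hs using hK s hs⟩
  have hleft : ∀ t ∈ Ioc 0 T, ∃ K : ℝ, ∀ᶠ s in 𝓝[<] t, |j s| ≤ K := by
    intro t ht
    obtain ⟨l, hl⟩ := hl t ht
    have h1 : ∀ᶠ s in 𝓝[<] t, (s ∈ Ioo 0 T ∧ s ∉ S) ∧ |deriv j s| ≤ |l| + 1 := by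
      refine (Eventually.and ?_ ?_).and (eventually_abs_le_of_tendsto hl)
      · filter_upwards [Ioo_mem_nhdsLT ht.1] with s hs
        exact ⟨hs.1, hs.2.trans_le ht.2⟩
      · exact (eventually_notMem_finset S t).filter_mono (nhdsWithin_mono _ fun s hs => ne_of_lt hs)
    obtain ⟨q, hq, hsub⟩ := (mem_nhdsLT_iff_exists_Ioo_subset).1 h1
    obtain ⟨K, hK⟩ := exists_abs_le_of_abs_deriv_le hq
      (fun s hs => (hS s (hsub hs).1.1 (hsub hs).1.2).1) (fun s hs => (hsub hs).2)
    exact ⟨K, by filter_upwards [Ioo_mem_nhdsLT hq] with s hs using hK s hs⟩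
  refine isCompact_Icc.induction_on (p := fun A => ∃ K : ℝ, ∀ s ∈ A, |j s| ≤ K) ⟨0, by simp⟩
    (fun A B hAB ⟨K, hK⟩ => ⟨K, fun s hs => hK s (hAB hs)⟩) ?_ ?_
  · rintro A B ⟨K, hK⟩ ⟨K', hK'⟩
    refine ⟨max K K', fun s hs => ?_⟩
    rcases hs with hs | hs
    · exact (hK s hs).trans (le_max_left _ _)
    · exact (hK' s hs).trans (le_max_right _ _)
  · intro t ht
    have hR : ∃ K : ℝ, ∀ᶠ s in 𝓝[>] t, s ∈ Icc 0 T → |j s| ≤ K := by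
      rcases ht.2.lt_or_eq with h | h
      · obtain ⟨K, hK⟩ := hright t ⟨ht.1, h⟩
        exact ⟨K, hK.mono fun s hs _ => hs⟩
      · refine ⟨0, ?_⟩
        filter_upwards [self_mem_nhdsWithin] with s hs hs'
        rw [h] at hs
        exact absurd hs'.2 (not_le.2 hs)
    have hL : ∃ K : ℝ, ∀ᶠ s in 𝓝[<] t, s ∈ Icc 0 T → |j s| ≤ K := by
      rcases ht.1.lt_or_eq with h | h
      · obtain ⟨K, hK⟩ := hleft t ⟨h, ht.2⟩
        exact ⟨K, hK.mono fun s hs _ => hs⟩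
      · refine ⟨0, ?_⟩
        filter_upwards [self_mem_nhdsWithin] with s hs hs'
        rw [← h] at hs
        exact absurd hs'.1 (not_le.2 hs)
    obtain ⟨K, hK⟩ := hR
    obtain ⟨K', hK'⟩ := hL
    -- The value |j t| enters separately because j may jump at t, so neither one-sided bound
    -- controls it.
    have hev : ∀ᶠ s in 𝓝 t, s ∈ Icc 0 T → |j s| ≤ max (max K K') |j t| := by
      rw [eventually_nhdsWithin_iff] at hK hK'
      filter_upwards [hK, hK'] with s h1 h2 h3
      rcases lt_trichotomy s t with h | h | h
      · exact (h2 h h3).trans ((le_max_right _ _).trans (le_max_left _ _))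
      · rw [h]; exact le_max_right _ _
      · exact (h1 h h3).trans ((le_max_left _ _).trans (le_max_left _ _))
    exact ⟨{s | |j s| ≤ max (max K K') |j t|}, eventually_nhdsWithin_iff.2 hev, _, fun s hs => hs⟩

lemma HasPiecewiseContinuousDeriv.intervalIntegrable {j : ℝ → ℝ}
    (hj : HasPiecewiseContinuousDeriv j) {T : ℝ} (hT : 0 < T) :
    IntervalIntegrable j volume 0 T := by
  obtain ⟨K, hK⟩ := hj.exists_abs_le hT
  obtain ⟨⟨S, hS⟩, -, -⟩ := hj T hT
  rw [intervalIntegrable_iff_integrableOn_Ioo_of_le hT.le]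
  have hm : AEStronglyMeasurable j (volume.restrict (Ioo 0 T)) := by
    have hc : ContinuousOn j (Ioo 0 T \ S) := fun s hs =>
      (hS s hs.1 hs.2).1.continuousAt.continuousWithinAt
    have hae : (Ioo 0 T \ (S : Set ℝ) : Set ℝ) =ᵐ[volume] Ioo 0 T :=
      sdiff_null_ae_eq_self (S.finite_toSet.measure_zero volume)
    rw [← Measure.restrict_congr_set hae]
    exact hc.aestronglyMeasurable (measurableSet_Ioo.diff S.finite_toSet.measurableSet)
  refine Integrable.of_bound hm K ?_
  exact (ae_restrict_iff' measurableSet_Ioo).2 (ae_of_all _ fun s hs =>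
    hK s (Ioo_subset_Icc_self hs))

/-- `∫₀ᵗ e^{-z²(t-s)} j(s) ds`. -/
def duhamel (j : ℝ → ℝ) (t : ℝ) (z : ℂ) : ℂ :=
  Complex.exp (-(z ^ 2 * t)) * jHat j (z ^ 2) t

lemma differentiable_duhamel {j : ℝ → ℝ} {t : ℝ} (hj : IntervalIntegrable j volume 0 t) :
    Differentiable ℂ (duhamel j t) := by
  have h : Differentiable ℂ fun z : ℂ => jHat j z t :=
    differentiable_integral_exp_mul (f := fun s => (j s : ℂ)) ⟨hj.1.ofReal, hj.2.ofReal⟩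
  have h2 : Differentiable ℂ fun z : ℂ => jHat j (z ^ 2) t :=
    h.comp (differentiable_id.pow 2)
  unfold duhamel
  fun_prop

/-- The integral is at most t, and κ times it is at most 1; adding t times the second bound to the
first gives the claim. This form decays in κ and stays valid at κ = 0. -/
lemma integral_exp_neg_mul_le {κ t : ℝ} (hκ : 0 ≤ κ) (ht : 0 ≤ t) :
    ∫ τ in (0 : ℝ)..t, Real.exp (-(κ * τ)) ≤ 2 * t / (1 + t * κ) := by
  have h1 : ∫ τ in (0 : ℝ)..t, Real.exp (-(κ * τ)) ≤ t := by
    have := intervalIntegral.integral_mono_on (μ := volume) (f := fun τ => Real.exp (-(κ * τ)))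
      (g := fun _ => (1 : ℝ)) ht (Continuous.intervalIntegrable (by fun_prop) _ _)
      (Continuous.intervalIntegrable (by fun_prop) _ _) (fun τ hτ => by
        simp only [Real.exp_le_one_iff, Left.neg_nonpos_iff]
        exact mul_nonneg hκ hτ.1)
    simpa using this
  have h2 : κ * ∫ τ in (0 : ℝ)..t, Real.exp (-(κ * τ)) ≤ 1 := by
    have h : ∫ τ in (0 : ℝ)..t, κ * Real.exp (-(κ * τ)) = 1 - Real.exp (-(κ * t)) := by
      have := intervalIntegral.integral_eq_sub_of_hasDerivAt (a := 0) (b := t)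
        (f := fun τ => -Real.exp (-(κ * τ))) (f' := fun τ => κ * Real.exp (-(κ * τ)))
        (fun τ _ => by
          have h1 : HasDerivAt (fun x => -(κ * x)) (-(κ * 1)) τ :=
            ((hasDerivAt_id τ).const_mul κ).neg
          have h2 : HasDerivAt (fun x => -Real.exp (-(κ * x)))
            (-(Real.exp (-(κ * τ)) * -(κ * 1))) τ := h1.exp.neg
          rwa [show -(Real.exp (-(κ * τ)) * -(κ * 1)) = κ * Real.exp (-(κ * τ)) by ring] at h2) (Continuous.intervalIntegrable (by fun_prop) _ _)
      rw [this]
      simp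
      ring
    rw [← intervalIntegral.integral_const_mul, h]
    linarith [Real.exp_pos (-(κ * t))]
  rw [le_div_iff₀ (by positivity)]
  nlinarith

/-- The weight E stands for |e^{izy}|. It has to be kept inside the estimate, since where Re z² < 0
it is what absorbs the growth of e^{-z²τ}. -/
lemma mul_norm_duhamel_le {j : ℝ → ℝ} {t K E A κ : ℝ} {z : ℂ} (ht : 0 ≤ t) (hκ : 0 ≤ κ)
    (hA : 0 ≤ A) (hE : 0 ≤ E) (hK : ∀ s ∈ Icc 0 t, |j s| ≤ K)
    (h : ∀ τ ∈ Icc 0 t, E * Real.exp (-((z ^ 2).re * τ)) ≤ A * Real.exp (-(κ * τ))) :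
    E * ‖duhamel j t z‖ ≤ A * K * (2 * t / (1 + t * κ)) := by
  have hK0 : 0 ≤ K := (abs_nonneg _).trans (hK 0 ⟨le_rfl, ht⟩)
  have e1 : (E : ℂ) * duhamel j t z
      = ∫ s in (0 : ℝ)..t, (E : ℂ) * (Complex.exp (-(z ^ 2 * (t - s : ℝ))) * (j s : ℂ)) := by
    rw [duhamel, jHat, intervalIntegral.integral_const_mul, ← intervalIntegral.integral_const_mul]
    congr 1
    refine intervalIntegral.integral_congr fun s _ => ?_
    rw [← mul_assoc, ← Complex.exp_add]
    congr 2
    push_cast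
    ring
  have e2 : E * ‖duhamel j t z‖ = ‖(E : ℂ) * duhamel j t z‖ := by
    rw [norm_mul, Complex.norm_real, Real.norm_of_nonneg hE]
  rw [e2, e1]
  have h3 := intervalIntegral.norm_integral_le_of_norm_le (μ := volume) ht
    (f := fun s : ℝ => (E : ℂ) * (Complex.exp (-(z ^ 2 * (t - s : ℝ))) * (j s : ℂ)))
    (g := fun s => A * K * Real.exp (-(κ * (t - s)))) (ae_of_all _ fun s hs => by
      rw [norm_mul, norm_mul, Complex.norm_real, Complex.norm_real, Real.norm_of_nonneg hE,
        Complex.norm_exp, Complex.neg_re, Complex.re_mul_ofReal, Real.norm_eq_abs, ← mul_assoc]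
      have h4 := h (t - s) ⟨by linarith [hs.2], by linarith [hs.1]⟩
      calc _ ≤ A * Real.exp (-(κ * (t - s))) * K := by
            gcongr
            exact hK s ⟨hs.1.le, hs.2⟩
        _ = _ := by ring) (Continuous.intervalIntegrable (by fun_prop) _ _)
  refine h3.trans ?_
  rw [intervalIntegral.integral_const_mul]
  gcongr
  have := intervalIntegral.integral_comp_sub_left (f := fun τ : ℝ => Real.exp (-(κ * τ)))
    (a := 0) (b := t) t
  rw [this]
  simpa using integral_exp_neg_mul_le hκ ht

/-! ### Kernel estimates on strips and sectors -/

/-- The common form of the integrands on `∂D₊` and (after reflection) on `∂D₋`. -/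
def kern (M N : ℂ → ℂ) (j : ℝ → ℝ) (y t : ℝ) (z : ℂ) : ℂ :=
  Complex.exp (Complex.I * z * y) * (Complex.exp (-(z ^ 2 * t)) * M z + N z * duhamel j t z)

lemma exp_neg_le_inv_one_add {x : ℝ} (hx : 0 ≤ x) : Real.exp (-x) ≤ 1 / (1 + x) := by
  rw [Real.exp_neg, ← one_div]
  exact one_div_le_one_div_of_le (by positivity) (by linarith [Real.add_one_le_exp x])

/-- One exponential estimate over 0 ≤ τ ≤ t serves both terms: τ = t controls the initial-data term,
the whole range the Duhamel term. -/
lemma norm_kern_le {M N : ℂ → ℂ} {j : ℝ → ℝ} {y t K A C κ : ℝ} {z : ℂ} (ht : 0 ≤ t) (hκ : 0 ≤ κ)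
    (hA : 0 ≤ A) (hK : ∀ s ∈ Icc 0 t, |j s| ≤ K) (hM : ‖M z‖ ≤ C) (hN : ‖N z‖ ≤ C)
    (h : ∀ τ ∈ Icc 0 t, ‖Complex.exp (Complex.I * z * y)‖ * Real.exp (-((z ^ 2).re * τ))
      ≤ A * Real.exp (-(κ * τ))) :
    ‖kern M N j y t z‖ ≤ C * A * (1 + 2 * K * t) / (1 + t * κ) := by
  have hC : 0 ≤ C := (norm_nonneg _).trans hM
  have h1 := mul_norm_duhamel_le ht hκ hA (norm_nonneg _) hK h
  have h2 := h t ⟨ht, le_rfl⟩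
  have h3 := exp_neg_le_inv_one_add (mul_nonneg hκ ht)
  rw [kern, mul_add]
  refine (norm_add_le _ _).trans ?_
  rw [norm_mul, norm_mul, norm_mul, norm_mul, Complex.norm_exp (-(z ^ 2 * t)), Complex.neg_re,
    Complex.re_mul_ofReal]
  have e1 : ‖Complex.exp (Complex.I * z * y)‖ * (Real.exp (-((z ^ 2).re * t)) * ‖M z‖)
      ≤ A * (1 / (1 + κ * t)) * C := by
    rw [← mul_assoc]
    exact mul_le_mul (h2.trans (by gcongr)) hM (norm_nonneg _) (by positivity)
  have e2 : ‖Complex.exp (Complex.I * z * y)‖ * (‖N z‖ * ‖duhamel j t z‖)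
      ≤ C * (A * K * (2 * t / (1 + t * κ))) := by
    rw [mul_left_comm]
    gcongr
  refine (add_le_add e1 e2).trans (le_of_eq ?_)
  rw [mul_comm κ t]
  ring

/-- `M` is holomorphic in the upper half-plane and bounded away from the real axis. -/
def HoloBounded (M : ℂ → ℂ) : Prop :=
  (∀ z : ℂ, 0 < z.im → DifferentiableAt ℂ M z) ∧
    ∀ a : ℝ, 0 < a → ∃ C : ℝ, ∀ z : ℂ, a ≤ z.im → ‖M z‖ ≤ C

lemma differentiableAt_kern {M N : ℂ → ℂ} (hM : HoloBounded M) (hN : HoloBounded N) {j : ℝ → ℝ}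
    {y t : ℝ} (hj : IntervalIntegrable j volume 0 t) {z : ℂ} (hz : 0 < z.im) :
    DifferentiableAt ℂ (kern M N j y t) z := by
  have h1 := hM.1 z hz
  have h2 := hN.1 z hz
  have h3 := differentiable_duhamel hj z
  unfold kern
  fun_prop

lemma one_div_one_add_mul_sq_le {m : ℝ} (hm : 0 < m) (r : ℝ) :
    1 / (1 + m * r ^ 2) ≤ (1 + 1 / m) / (1 + r ^ 2) := by
  rw [div_le_div_iff₀ (by positivity) (by positivity)]
  have : (1 + 1 / m) * (1 + m * r ^ 2) = 1 + r ^ 2 + 1 / m + m * r ^ 2 := by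
    field_simp
    ring
  rw [this]
  have := one_div_pos.2 hm
  nlinarith [sq_nonneg r]

/-- On Im z = v one has Re z² = σ² - v², so the decay in σ comes from e^{-z²t} and the Duhamel
integral alone. The constant is therefore uniform in y ≥ 0, which later allows x to reach the end
points. -/
lemma exists_norm_kern_strip_le {M N : ℂ → ℂ} (hM : HoloBounded M) (hN : HoloBounded N)
    {j : ℝ → ℝ} {t K a b : ℝ} (ht : 0 < t) (hK : ∀ s ∈ Icc 0 t, |j s| ≤ K) (ha : 0 < a) :
    ∃ C : ℝ, ∀ y : ℝ, 0 ≤ y → ∀ σ v : ℝ, v ∈ Icc a b →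
      ‖kern M N j y t (σ + v * Complex.I)‖ ≤ C / (1 + σ ^ 2) := by
  obtain ⟨C₁, hC₁⟩ := hM.2 a ha
  obtain ⟨C₂, hC₂⟩ := hN.2 a ha
  have hK0 : 0 ≤ K := (abs_nonneg _).trans (hK 0 ⟨le_rfl, ht.le⟩)
  refine ⟨max C₁ C₂ * Real.exp (b ^ 2 * t) * (1 + 2 * K * t) * (1 + 1 / t), fun y hy σ v hv => ?_⟩
  have him : (σ + v * Complex.I : ℂ).im = v := by simp
  have hre : ((σ + v * Complex.I : ℂ) ^ 2).re = σ ^ 2 - v ^ 2 := by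
    rw [pow_two, Complex.mul_re]; simp; ring
  have hm1 := (hC₁ (σ + v * Complex.I) (by rw [him]; exact hv.1)).trans (le_max_left C₁ C₂)
  have hm2 := (hC₂ (σ + v * Complex.I) (by rw [him]; exact hv.1)).trans (le_max_right C₁ C₂)
  have hC0 := (norm_nonneg _).trans hm1
  have h := norm_kern_le (j := j) (y := y) (κ := σ ^ 2) (A := Real.exp (b ^ 2 * t)) ht.le
    (sq_nonneg σ) (Real.exp_pos _).le hK hm1 hm2 (fun τ hτ => by
      rw [Complex.norm_exp, hre, ← Real.exp_add, ← Real.exp_add]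
      refine Real.exp_le_exp.2 ?_
      have : (Complex.I * (σ + v * Complex.I) * y).re = -(v * y) := by
        simp
      rw [this]
      have hv0 : 0 ≤ v := ha.le.trans hv.1
      have h1 : v ^ 2 * τ ≤ b ^ 2 * t := by
        have := hτ.1
        have := hτ.2
        have := hv.2
        gcongr
      nlinarith [mul_nonneg hv0 hy])
  refine h.trans ?_
  have h2 := one_div_one_add_mul_sq_le ht σ
  calc _ = max C₁ C₂ * Real.exp (b ^ 2 * t) * (1 + 2 * K * t) * (1 / (1 + t * σ ^ 2)) := by ring
    _ ≤ max C₁ C₂ * Real.exp (b ^ 2 * t) * (1 + 2 * K * t) * ((1 + 1 / t) / (1 + σ ^ 2)) := by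
        gcongr
    _ = _ := by ring

lemma ray_im (ε r θ : ℝ) :
    ((ε * Complex.I : ℂ) + r * Complex.exp (θ * Complex.I)).im = ε + r * Real.sin θ := by
  simp [Complex.exp_im]

lemma ray_sq_re (ε r θ : ℝ) :
    (((ε * Complex.I : ℂ) + r * Complex.exp (θ * Complex.I)) ^ 2).re
      = r ^ 2 * (1 - 2 * Real.sin θ ^ 2) - 2 * ε * r * Real.sin θ - ε ^ 2 := by
  have hre : ((ε * Complex.I : ℂ) + r * Complex.exp (θ * Complex.I)).re = r * Real.cos θ := by
    simp [Complex.exp_re]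
  rw [pow_two, Complex.mul_re, ray_im, hre]
  have := Real.sin_sq_add_cos_sq θ
  linear_combination r ^ 2 * this

/-- The condition on sin θ makes the quadratic part r²(1 - 2 sin²θ) of Re z² nonnegative. The cross
term of the shift contributes growth of at most e^{2εt r sin θ}, and e^{izy} beats it by the margin
δ = y - 2εt. Near the real direction the quadratic part gives the decay, near the sector boundary
this margin does. -/
lemma exists_norm_kern_sector_le {M N : ℂ → ℂ} (hM : HoloBounded M) (hN : HoloBounded N)
    {j : ℝ → ℝ} {y t K ε : ℝ} (ht : 0 < t) (hK : ∀ s ∈ Icc 0 t, |j s| ≤ K) (hε : 0 < ε)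
    (hy : 2 * ε * t < y) :
    ∃ C : ℝ, ∀ θ : ℝ, 0 ≤ Real.sin θ → Real.sin θ ^ 2 ≤ 1 / 2 → ∀ r : ℝ, 0 < r →
      ‖kern M N j y t ((ε * Complex.I : ℂ) + r * Complex.exp (θ * Complex.I))‖ ≤
        C / (1 + r ^ 2) := by
  obtain ⟨C₁, hC₁⟩ := hM.2 ε hε
  obtain ⟨C₂, hC₂⟩ := hN.2 ε hε
  have hK0 : 0 ≤ K := (abs_nonneg _).trans (hK 0 ⟨le_rfl, ht.le⟩)
  set δ := y - 2 * ε * t with hδ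
  have hδ0 : 0 < δ := by linarith
  have hy0 : 0 < y := lt_trans (by positivity) hy
  set A := Real.exp (ε ^ 2 * t) with hA
  have hA0 : 0 < A := Real.exp_pos _
  set B := max C₁ C₂ * A * (1 + 2 * K * t) with hB
  refine ⟨B * ((1 + 1 / (t / 2)) + (1 + 1 / (δ ^ 2 / 8))), fun θ hs hs2 r hr => ?_⟩
  set z : ℂ := (ε * Complex.I : ℂ) + r * Complex.exp (θ * Complex.I) with hz
  set s := Real.sin θ with hsdef
  have him : z.im = ε + r * s := ray_im ε r θ
  have hre : (z ^ 2).re = r ^ 2 * (1 - 2 * s ^ 2) - 2 * ε * r * s - ε ^ 2 := ray_sq_re ε r θ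
  have hzε : ε ≤ z.im := by rw [him]; nlinarith [mul_nonneg hr.le hs]
  have hm1 := (hC₁ z hzε).trans (le_max_left C₁ C₂)
  have hm2 := (hC₂ z hzε).trans (le_max_right C₁ C₂)
  have hC0 := (norm_nonneg _).trans hm1
  have hB0 : 0 ≤ B := by positivity
  have hnorm : ‖Complex.exp (Complex.I * z * y)‖ = Real.exp (-((ε + r * s) * y)) := by
    rw [Complex.norm_exp, Complex.re_mul_ofReal, Complex.I_mul_re, him]
    congr 1; ring
  have hrs : 0 ≤ r * s := mul_nonneg hr.le hs
  have hexp : ∀ τ ∈ Icc 0 t, -((ε + r * s) * y) + -((z ^ 2).re * τ)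
      ≤ ε ^ 2 * t - δ * (r * s) - τ * (r ^ 2 * (1 - 2 * s ^ 2)) := by
    intro τ hτ
    rw [hre, hδ]
    have h1 : ε * (r * s) * τ ≤ ε * (r * s) * t := by
      have := hτ.2; gcongr
    have h2 : ε ^ 2 * τ ≤ ε ^ 2 * t := by have := hτ.2; gcongr
    nlinarith [mul_pos hε hy0]
  have hp1 := one_div_pos.2 (half_pos ht)
  have hp2 : 0 < 1 / (δ ^ 2 / 8) := by positivity
  rcases le_total s (1 / 2) with hsh | hsh
  · have h := norm_kern_le (j := j) (y := y) (κ := r ^ 2 / 2) (A := A) ht.le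
      (by positivity) hA0.le hK hm1 hm2 (fun τ hτ => by
        rw [hnorm, ← Real.exp_add, hA, ← Real.exp_add]
        refine Real.exp_le_exp.2 ((hexp τ hτ).trans ?_)
        have h1 : s ^ 2 ≤ 1 / 4 := by nlinarith
        have h2 : τ * (r ^ 2 * (1 / 2)) ≤ τ * (r ^ 2 * (1 - 2 * s ^ 2)) := by
          have := hτ.1
          gcongr
          linarith
        nlinarith [mul_nonneg hδ0.le hrs])
    refine h.trans ?_
    have h2 := one_div_one_add_mul_sq_le (half_pos ht) r
    calc _ = B * (1 / (1 + t / 2 * r ^ 2)) := by rw [hB]; ring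
      _ ≤ B * ((1 + 1 / (t / 2)) / (1 + r ^ 2)) := by gcongr
      _ ≤ B * (((1 + 1 / (t / 2)) + (1 + 1 / (δ ^ 2 / 8))) / (1 + r ^ 2)) :=
          mul_le_mul_of_nonneg_left
            (div_le_div_of_nonneg_right (by linarith) (by positivity)) hB0
      _ = _ := by ring
  -- For sin θ ≥ 1/2 the quadratic part may vanish, so κ = 0 and all decay comes from e^{-δr/2}. The
  -- constant δ²/8 below is the quadratic Taylor term of e^{δr/2}.
  · have h := norm_kern_le (j := j) (y := y) (κ := 0) (A := A * Real.exp (-(δ * r / 2))) ht.le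
      le_rfl (by positivity) hK hm1 hm2 (fun τ hτ => by
        rw [hnorm, ← Real.exp_add, hA, ← Real.exp_add, ← Real.exp_add]
        refine Real.exp_le_exp.2 ((hexp τ hτ).trans ?_)
        have h1 : 0 ≤ τ * (r ^ 2 * (1 - 2 * s ^ 2)) :=
          mul_nonneg hτ.1 (mul_nonneg (sq_nonneg r) (by linarith))
        have h2 : δ * (r * (1 / 2)) ≤ δ * (r * s) := by gcongr
        linarith)
    refine h.trans ?_
    have h2 := one_div_one_add_mul_sq_le (m := δ ^ 2 / 8) (by positivity) r
    have h3 : Real.exp (-(δ * r / 2)) ≤ 1 / (1 + δ ^ 2 / 8 * r ^ 2) := by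
      rw [Real.exp_neg, ← one_div]
      refine one_div_le_one_div_of_le (by positivity) ?_
      have h4 := Real.quadratic_le_exp_of_nonneg (x := δ * r / 2) (by positivity)
      have h5 : 0 < δ * r / 2 := by positivity
      nlinarith
    calc _ = B * Real.exp (-(δ * r / 2)) := by rw [hB]; ring
      _ ≤ B * (1 / (1 + δ ^ 2 / 8 * r ^ 2)) := by gcongr
      _ ≤ B * ((1 + 1 / (δ ^ 2 / 8)) / (1 + r ^ 2)) := by gcongr
      _ ≤ B * (((1 + 1 / (t / 2)) + (1 + 1 / (δ ^ 2 / 8))) / (1 + r ^ 2)) :=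
          mul_le_mul_of_nonneg_left
            (div_le_div_of_nonneg_right (by linarith) (by positivity)) hB0
      _ = _ := by ring

/-! ### From the sector boundaries to the line Im z = 1 -/

lemma sin_bounds_of_le_pi_div_four {θ : ℝ} (h : θ ∈ Icc 0 (Real.pi / 4)) :
    0 ≤ Real.sin θ ∧ Real.sin θ ^ 2 ≤ 1 / 2 := by
  have hpi := Real.pi_pos
  have h0 := Real.sin_nonneg_of_nonneg_of_le_pi h.1 (by linarith [h.2])
  refine ⟨h0, ?_⟩
  have h1 : Real.sin θ ≤ Real.sin (Real.pi / 4) :=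
    Real.sin_le_sin_of_le_of_le_pi_div_two (by linarith [h.1]) (by linarith) h.2
  rw [Real.sin_pi_div_four] at h1
  have := Real.sq_sqrt (show (0 : ℝ) ≤ 2 by norm_num)
  nlinarith

lemma sin_bounds_of_three_pi_div_four_le {θ : ℝ} (h : θ ∈ Icc (3 * Real.pi / 4) Real.pi) :
    0 ≤ Real.sin θ ∧ Real.sin θ ^ 2 ≤ 1 / 2 := by
  rw [← Real.sin_pi_sub]
  exact sin_bounds_of_le_pi_div_four ⟨by linarith [h.2], by linarith [h.1]⟩

lemma rayIntegral_zero_sub_rayIntegral_pi {F : ℂ → ℂ} {a : ℂ}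
    (hF : Integrable fun x : ℝ => F (x + a)) :
    rayIntegral F a 0 - rayIntegral F a Real.pi = ∫ x : ℝ, F (x + a) := by
  have h1 : rayIntegral F a 0 = ∫ x in Ioi (0 : ℝ), F (x + a) := by
    simp [rayIntegral, add_comm]
  have h2 : rayIntegral F a Real.pi = -∫ x in Iic (0 : ℝ), F (x + a) := by
    have := integral_comp_neg_Ioi (0 : ℝ) fun x : ℝ => F (x + a)
    rw [neg_zero] at this
    rw [← this, rayIntegral, ← integral_neg]
    simp [Complex.exp_pi_mul_I, add_comm]
  rw [h1, h2, sub_neg_eq_add, add_comm]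
  exact intervalIntegral.integral_Iic_add_Ioi hF.integrableOn hF.integrableOn

/-- The integral over `∂D₊` may be moved to the line `Im z = 1`. -/
lemma integralDPlus_kern {M N : ℂ → ℂ} (hM : HoloBounded M) (hN : HoloBounded N)
    {j : ℝ → ℝ} {y t K ε : ℝ} (ht : 0 < t) (hK : ∀ s ∈ Icc 0 t, |j s| ≤ K)
    (hj : IntervalIntegrable j volume 0 t) (hε : 0 < ε) (hy : 2 * ε * t < y) :
    RayIntegrable (kern M N j y t) (ε * Complex.I) (Real.pi / 4) ∧
    RayIntegrable (kern M N j y t) (ε * Complex.I) (3 * Real.pi / 4) ∧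
    integralDPlus ε (kern M N j y t) = ∫ σ : ℝ, kern M N j y t (σ + Complex.I) := by
  obtain ⟨C, hC⟩ := exists_norm_kern_sector_le hM hN ht hK hε hy
  have hpi := Real.pi_pos
  have hy0 : 0 < y := lt_trans (by positivity) hy
  have hd : ∀ θ : ℝ, 0 ≤ Real.sin θ → ∀ r : ℝ, 0 < r → DifferentiableAt ℂ (kern M N j y t)
      ((ε * Complex.I : ℂ) + r * Complex.exp (θ * Complex.I)) := by
    intro θ hθ r hr
    refine differentiableAt_kern hM hN hj ?_
    rw [ray_im]
    nlinarith [mul_nonneg hr.le hθ]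
  have hr : ∀ θ : ℝ, (0 ≤ Real.sin θ ∧ Real.sin θ ^ 2 ≤ 1 / 2) →
      RayIntegrable (kern M N j y t) (ε * Complex.I) θ := fun θ hθ =>
    rayIntegrable_of_decay (hd θ hθ.1) (hC θ hθ.1 hθ.2)
  refine ⟨hr _ (sin_bounds_of_le_pi_div_four ⟨by linarith, le_rfl⟩),
    hr _ (sin_bounds_of_three_pi_div_four_le ⟨le_rfl, by linarith⟩), ?_⟩
  -- The rays turn away from the interior of D₊, through the wedges π/4 → 0 and 3π/4 → π, where Re
  -- of the squared direction is nonnegative. Together they become the full line Im z = ε.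
  have e1 : rayIntegral (kern M N j y t) (ε * Complex.I) 0
      = rayIntegral (kern M N j y t) (ε * Complex.I) (Real.pi / 4) :=
    rayIntegral_eq_of_decay (by linarith)
      (fun θ hθ => hd θ (sin_bounds_of_le_pi_div_four hθ).1)
      (fun θ hθ => hC θ (sin_bounds_of_le_pi_div_four hθ).1 (sin_bounds_of_le_pi_div_four hθ).2)
  have e2 : rayIntegral (kern M N j y t) (ε * Complex.I) (3 * Real.pi / 4)
      = rayIntegral (kern M N j y t) (ε * Complex.I) Real.pi :=
    rayIntegral_eq_of_decay (by linarith)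
      (fun θ hθ => hd θ (sin_bounds_of_three_pi_div_four_le hθ).1)
      (fun θ hθ => hC θ (sin_bounds_of_three_pi_div_four_le hθ).1
        (sin_bounds_of_three_pi_div_four_le hθ).2)
  have hshift : ∀ a b : ℝ, 0 < a → a ≤ b →
      (Integrable fun σ : ℝ => kern M N j y t (σ + a * Complex.I)) ∧
      ∫ σ : ℝ, kern M N j y t (σ + a * Complex.I) = ∫ σ : ℝ, kern M N j y t (σ + b * Complex.I) := by
    intro a b ha hab
    obtain ⟨C', hC'⟩ := exists_norm_kern_strip_le hM hN (b := b) ht hK ha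
    have := integral_horizontal_line_eq_of_decay hab
      (fun z hz => differentiableAt_kern (y := y) hM hN hj (ha.trans_le hz.1)) (hC' y hy0.le)
    exact ⟨this.1 a ⟨le_rfl, hab⟩, this.2⟩
  rw [integralDPlus, sectorBoundaryIntegral, ← e1, e2,
    rayIntegral_zero_sub_rayIntegral_pi (hshift ε ε hε le_rfl).1]
  rcases le_total ε 1 with h | h
  · simpa using (hshift ε 1 hε h).2
  · simpa using (hshift 1 ε one_pos h).2.symm

lemma rayIntegral_neg_base (F : ℂ → ℂ) (a : ℂ) (θ : ℝ) :
    rayIntegral F (-a) (Real.pi + θ) = -rayIntegral (fun z => F (-z)) a θ := by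
  have h : Complex.exp ((Real.pi + θ : ℝ) * Complex.I) = -Complex.exp (θ * Complex.I) := by
    push_cast
    rw [add_mul, Complex.exp_add, Complex.exp_pi_mul_I]
    ring
  rw [rayIntegral, rayIntegral, ← integral_neg]
  simp only [h]
  congr 1
  ext r
  rw [mul_neg]
  congr 3
  ring

lemma rayIntegrable_neg_base {F : ℂ → ℂ} {a : ℂ} {θ : ℝ}
    (h : RayIntegrable (fun z => F (-z)) a θ) : RayIntegrable F (-a) (Real.pi + θ) := by
  have he : Complex.exp ((Real.pi + θ : ℝ) * Complex.I) = -Complex.exp (θ * Complex.I) := by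
    push_cast
    rw [add_mul, Complex.exp_add, Complex.exp_pi_mul_I]
    ring
  unfold RayIntegrable at h ⊢
  simp only [he]
  convert h using 3
  ring

/-- Reflection in the origin exchanges the two contours. -/
lemma integralDMinus_eq (ε : ℝ) (F : ℂ → ℂ) :
    integralDMinus ε F = -integralDPlus ε (fun z => F (-z)) := by
  rw [integralDMinus, integralDPlus, sectorBoundaryIntegral, sectorBoundaryIntegral,
    show 5 * Real.pi / 4 = Real.pi + Real.pi / 4 by ring,
    show 7 * Real.pi / 4 = Real.pi + 3 * Real.pi / 4 by ring, rayIntegral_neg_base,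
    rayIntegral_neg_base]
  ring

lemma elem_eq (x t : ℝ) (z : ℂ) :
    elem x t z = Complex.exp (Complex.I * z * x) * Complex.exp (-(z ^ 2 * t)) := by
  rw [elem, ← Complex.exp_add, sub_eq_add_neg]

lemma integrandPlus_eq (u₀ j : ℝ → ℝ) (x t : ℝ) :
    integrandPlus u₀ j x t = kern (coefPlus u₀) fluxPlus j x t := by
  ext z
  rw [integrandPlus, kern, elem_eq, coefPlus, fluxPlus, duhamel, mu0]
  ring

/-- Subtracting Δ(λ)û₀(-iλ) leaves an initial-data term which, at λ = -z, has the common factor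
e^{iz}. Combined with e^{-izx} this is e^{iz(1-x)}, decaying upwards. The flux term lacks that
factor, so `fluxMinus` carries e^{-iz}, which the growth of Δ compensates. -/
lemma integrandMinus_neg_eq (u₀ j : ℝ → ℝ) (x t : ℝ) :
    (fun z => integrandMinus u₀ j x t (-z)) = kern (coefMinus u₀) fluxMinus j (1 - x) t := by
  ext z
  have hmu : mu1 u₀ j t (-z) = -((1 - Complex.I * z) * Complex.exp (Complex.I * z)
      * (uHat u₀ (Complex.I * z) - uHat u₀ (-(Complex.I * z)))
      + 2 * Complex.I * z * jHat j (z ^ 2) t) := by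
    rw [mu1, mu0, Delta_neg, Delta]
    simp only [mul_neg, neg_neg, neg_sq]
    ring
  have h1 : Complex.exp (Complex.I * z * (1 - x : ℝ))
      = Complex.exp (Complex.I * z) * Complex.exp (Complex.I * -z * x) := by
    rw [← Complex.exp_add]; congr 1; push_cast; ring
  have h2 : Complex.exp (Complex.I * z) * Complex.exp (-(Complex.I * z)) = 1 := by
    rw [← Complex.exp_add]; simp
  rw [integrandMinus, kern, elem_eq, Delta_neg, hmu, coefMinus, fluxMinus, duhamel, h1, neg_sq,
    div_mul_eq_mul_div, mul_neg, neg_div_neg_eq]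
  simp only [div_eq_mul_inv]
  linear_combination (-2 * Complex.exp (Complex.I * -z * x) * Complex.I * z * (Delta z)⁻¹
    * Complex.exp (-(z ^ 2 * t)) * jHat j (z ^ 2) t) * h2

lemma holoBounded_fluxPlus : HoloBounded fluxPlus :=
  ⟨fun _ => differentiableAt_fluxPlus, fun _ ha =>
    (exists_norm_coef_le ha).imp fun _ hC z hz => (hC.2 z hz).1⟩

lemma holoBounded_fluxMinus : HoloBounded fluxMinus :=
  ⟨fun _ => differentiableAt_fluxMinus, fun _ ha =>
    (exists_norm_coef_le ha).imp fun _ hC z hz => (hC.2 z hz).2.1⟩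

lemma continuousOn_comp_one_sub {u : ℝ → ℝ} (hu : ContinuousOn u (Icc 0 1)) :
    ContinuousOn (fun x => u (1 - x)) (Icc 0 1) :=
  hu.comp (by fun_prop) fun x hx => ⟨by linarith [hx.2], by linarith [hx.1]⟩

lemma exists_norm_coef_bounds {u : ℝ → ℝ} (hu : ContinuousOn u (Icc 0 1)) {a : ℝ} (ha : 0 < a) :
    ∃ C : ℝ, ∀ z : ℂ, a ≤ z.im → ‖coefPlus u z‖ ≤ C ∧ ‖coefMinus u z‖ ≤ C := by
  obtain ⟨C, -, hC⟩ := exists_norm_coef_le ha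
  obtain ⟨K, hK⟩ := exists_norm_uHat_le hu
  obtain ⟨K', hK'⟩ := exists_norm_uHat_le (continuousOn_comp_one_sub hu)
  refine ⟨C * max K K', fun z hz => (hC z hz).2.2 u _ ?_ ?_⟩
  · exact (hK _ (by simp; linarith)).trans (le_max_left _ _)
  · rw [exp_mul_uHat_neg]
    exact (hK' _ (by simp; linarith)).trans (le_max_right _ _)

lemma holoBounded_coefPlus {u : ℝ → ℝ} (hu : ContinuousOn u (Icc 0 1)) :
    HoloBounded (coefPlus u) :=
  ⟨fun _ => differentiableAt_coefPlus hu, fun _ ha =>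
    (exists_norm_coef_bounds hu ha).imp fun _ hC z hz => (hC z hz).1⟩

lemma holoBounded_coefMinus {u : ℝ → ℝ} (hu : ContinuousOn u (Icc 0 1)) :
    HoloBounded (coefMinus u) :=
  ⟨fun _ => differentiableAt_coefMinus hu, fun _ ha =>
    (exists_norm_coef_bounds hu ha).imp fun _ hC z hz => (hC z hz).2⟩

/-! ### The line solution: continuity and agreement with the representation -/

lemma norm_integrandReal_le {u : ℝ → ℝ} {U : ℝ} (hU : ∀ w : ℂ, w.re ≤ 0 → ‖uHat u w‖ ≤ U)
    (x t l : ℝ) : ‖integrandReal u x t l‖ ≤ U * Real.exp (-t * l ^ 2) := by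
  rw [integrandReal, elem, norm_mul, Complex.norm_exp, mul_comm]
  have h1 := hU (-(Complex.I * l)) (by simp)
  have h2 : (Complex.I * l * x - (l : ℂ) ^ 2 * t).re = -t * l ^ 2 := by
    rw [show Complex.I * l * x - (l : ℂ) ^ 2 * t
      = ((l * x : ℝ) : ℂ) * Complex.I + ((-t * l ^ 2 : ℝ) : ℂ) by push_cast; ring]
    rw [Complex.add_re, Complex.re_ofReal_mul, Complex.I_re, Complex.ofReal_re]
    ring
  rw [h2]
  gcongr

lemma continuous_integrandReal_right {u : ℝ → ℝ} (hu : ContinuousOn u (Icc 0 1)) (x t : ℝ) :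
    Continuous fun l : ℝ => integrandReal u x t l := by
  have := (differentiable_uHat hu).continuous
  unfold integrandReal elem
  fun_prop

lemma continuous_integrandReal_left (u : ℝ → ℝ) (t : ℝ) (z : ℂ) :
    Continuous fun x : ℝ => integrandReal u x t z := by
  unfold integrandReal elem
  fun_prop

lemma integrable_integrandReal {u : ℝ → ℝ} (hu : ContinuousOn u (Icc 0 1)) (x : ℝ) {t : ℝ}
    (ht : 0 < t) : Integrable fun l : ℝ => integrandReal u x t l := by
  obtain ⟨U, hU⟩ := exists_norm_uHat_le hu
  refine ((integrable_exp_neg_mul_sq ht).const_mul U).mono' ?_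
    (ae_of_all _ fun l => norm_integrandReal_le hU x t l)
  exact (continuous_integrandReal_right hu x t).aestronglyMeasurable

/-- The solution, given by integrals over horizontal lines. -/
def lineSolution (u₀ j : ℝ → ℝ) (x t : ℝ) : ℂ :=
  1 / (2 * (Real.pi : ℂ)) *
    ((∫ l : ℝ, integrandReal u₀ x t l)
      - (∫ σ : ℝ, kern (coefPlus u₀) fluxPlus j x t (σ + Complex.I))
      + ∫ σ : ℝ, kern (coefMinus u₀) fluxMinus j (1 - x) t (σ + Complex.I))

/-- Dominated convergence with the strip bound at height one, whose majorant does not depend on y.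
-/
lemma continuousOn_integral_kern {M N : ℂ → ℂ} (hM : HoloBounded M) (hN : HoloBounded N)
    {j : ℝ → ℝ} {t K : ℝ} (ht : 0 < t) (hK : ∀ s ∈ Icc 0 t, |j s| ≤ K)
    (hj : IntervalIntegrable j volume 0 t) :
    ContinuousOn (fun y => ∫ σ : ℝ, kern M N j y t (σ + Complex.I)) (Icc 0 1) := by
  obtain ⟨C, hC⟩ := exists_norm_kern_strip_le hM hN (b := 1) ht hK one_pos
  refine continuousOn_of_dominated (bound := fun σ => C / (1 + σ ^ 2)) ?_ ?_
    (integrable_const_div_one_add_sq C) ?_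
  · intro y _
    refine Continuous.aestronglyMeasurable (continuous_iff_continuousAt.2 fun σ => ?_)
    exact ContinuousAt.comp (f := fun σ : ℝ => (σ + Complex.I : ℂ))
      (differentiableAt_kern hM hN hj (by simp)).continuousAt (by fun_prop)
  · intro y hy
    refine ae_of_all _ fun σ => ?_
    simpa using hC y hy.1 σ 1 ⟨le_rfl, le_rfl⟩
  · refine ae_of_all _ fun σ => Continuous.continuousOn ?_
    unfold kern
    fun_prop

lemma continuousOn_lineSolution {u₀ j : ℝ → ℝ} (hu : ContinuousOn u₀ (Icc 0 1)) {t K : ℝ}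
    (ht : 0 < t) (hK : ∀ s ∈ Icc 0 t, |j s| ≤ K) (hj : IntervalIntegrable j volume 0 t) :
    ContinuousOn (fun x => lineSolution u₀ j x t) (Icc 0 1) := by
  unfold lineSolution
  refine continuousOn_const.mul (ContinuousOn.add (ContinuousOn.sub ?_ ?_) ?_)
  · obtain ⟨U, hU⟩ := exists_norm_uHat_le hu
    refine Continuous.continuousOn (continuous_of_dominated
      (bound := fun l => U * Real.exp (-t * l ^ 2)) ?_ ?_ ?_ ?_)
    · exact fun x => (integrable_integrandReal hu x ht).aestronglyMeasurable
    · exact fun x => ae_of_all _ fun l => norm_integrandReal_le hU x t l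
    · exact (integrable_exp_neg_mul_sq ht).const_mul U
    · exact ae_of_all _ fun l => continuous_integrandReal_left u₀ t l
  · exact continuousOn_integral_kern (holoBounded_coefPlus hu) holoBounded_fluxPlus ht hK hj
  · exact (continuousOn_integral_kern (holoBounded_coefMinus hu) holoBounded_fluxMinus ht hK
      hj).comp (f := fun x : ℝ => 1 - x) (by fun_prop)
      fun x hx => ⟨by linarith [hx.2], by linarith [hx.1]⟩

/-- The function given by integrals over horizontal lines is the represented solution. -/
lemma isRepresentedSolution_lineSolution {u₀ j : ℝ → ℝ} (hu : ContinuousOn u₀ (Icc 0 1))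
    (hj : HasPiecewiseContinuousDeriv j) : IsRepresentedSolution u₀ j (lineSolution u₀ j) := by
  intro t ht
  obtain ⟨K, hK⟩ := hj.exists_abs_le ht
  have hji := hj.intervalIntegrable ht
  refine ⟨continuousOn_lineSolution hu ht hK hji, fun x hx ε hε h1 h2 => ?_⟩
  obtain ⟨a1, a2, a3⟩ := integralDPlus_kern (holoBounded_coefPlus hu) holoBounded_fluxPlus ht hK
    hji hε h1
  obtain ⟨b1, b2, b3⟩ := integralDPlus_kern (holoBounded_coefMinus hu) holoBounded_fluxMinus ht hK
    hji hε h2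
  rw [← integrandPlus_eq u₀ j x t] at a1 a2 a3
  rw [← integrandMinus_neg_eq u₀ j x t] at b1 b2 b3
  refine ⟨⟨integrable_integrandReal hu x ht, a1, a2, ?_, ?_⟩, ?_⟩
  · rw [show 5 * Real.pi / 4 = Real.pi + Real.pi / 4 by ring]
    exact rayIntegrable_neg_base (F := integrandMinus u₀ j x t) b1
  · rw [show 7 * Real.pi / 4 = Real.pi + 3 * Real.pi / 4 by ring]
    exact rayIntegrable_neg_base (F := integrandMinus u₀ j x t) b2
  · rw [representation, integralDMinus_eq, a3, b3, lineSolution, sub_neg_eq_add, integrandPlus_eq,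
      ← integrandMinus_neg_eq u₀ j x t]

/-! ### Linearity in the data and the contribution of the flux -/

lemma uHat_linear {u v : ℝ → ℝ} (hu : ContinuousOn u (Icc 0 1)) (hv : ContinuousOn v (Icc 0 1))
    (a : ℝ) (w : ℂ) : uHat (fun x => a * u x + v x) w = a * uHat u w + uHat v w := by
  have h : ∀ {f : ℝ → ℝ}, ContinuousOn f (Icc 0 1) →
      IntervalIntegrable (fun x : ℝ => Complex.exp (w * x) * (f x : ℂ)) volume 0 1 := by
    intro f hf
    refine ContinuousOn.intervalIntegrable ?_
    rw [uIcc_of_le zero_le_one]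
    exact ContinuousOn.mul (by fun_prop) (Complex.continuous_ofReal.comp_continuousOn hf)
  rw [uHat, uHat, uHat, ← intervalIntegral.integral_const_mul,
    ← intervalIntegral.integral_add ((h hu).const_mul _) (h hv)]
  refine intervalIntegral.integral_congr fun x _ => ?_
  push_cast
  ring

lemma duhamel_zero (t : ℝ) (z : ℂ) : duhamel 0 t z = 0 := by
  simp [duhamel, jHat]

lemma integrable_kern {M N : ℂ → ℂ} (hM : HoloBounded M) (hN : HoloBounded N)
    {j : ℝ → ℝ} {y t K : ℝ} (hy : 0 ≤ y) (ht : 0 < t) (hK : ∀ s ∈ Icc 0 t, |j s| ≤ K)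
    (hj : IntervalIntegrable j volume 0 t) :
    Integrable fun σ : ℝ => kern M N j y t (σ + Complex.I) := by
  obtain ⟨C, hC⟩ := exists_norm_kern_strip_le hM hN (b := 1) ht hK one_pos
  refine (integrable_const_div_one_add_sq C).mono' ?_ (ae_of_all _ fun σ => ?_)
  · refine Continuous.aestronglyMeasurable (continuous_iff_continuousAt.2 fun σ => ?_)
    exact ContinuousAt.comp (f := fun σ : ℝ => (σ + Complex.I : ℂ))
      (differentiableAt_kern hM hN hj (by simp)).continuousAt (by fun_prop)
  · simpa using hC y hy σ 1 ⟨le_rfl, le_rfl⟩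

/-- The flux is attached to the second summand only. One form thus serves both to split off the
multiple of x and, with a = 1 and v = 0, to separate the initial data from j. -/
lemma lineSolution_linear {u v j : ℝ → ℝ} (hu : ContinuousOn u (Icc 0 1))
    (hv : ContinuousOn v (Icc 0 1)) (a : ℝ) {x t K : ℝ} (hx : x ∈ Icc (0 : ℝ) 1) (ht : 0 < t)
    (hK : ∀ s ∈ Icc 0 t, |j s| ≤ K) (hj : IntervalIntegrable j volume 0 t) :
    lineSolution (fun x => a * u x + v x) j x t
      = a * lineSolution u 0 x t + lineSolution v j x t := by
  have hx' : 0 ≤ 1 - x := by linarith [hx.2]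
  have h0 : IntervalIntegrable (0 : ℝ → ℝ) volume 0 t := intervalIntegrable_const
  have hK0 : ∀ s ∈ Icc 0 t, |(0 : ℝ → ℝ) s| ≤ 0 := by simp
  have e1 : (∫ l : ℝ, integrandReal (fun x => a * u x + v x) x t l)
      = a * (∫ l : ℝ, integrandReal u x t l) + ∫ l : ℝ, integrandReal v x t l := by
    rw [← integral_const_mul, ← integral_add ((integrable_integrandReal hu x ht).const_mul _)
      (integrable_integrandReal hv x ht)]
    congr 1
    ext l
    rw [integrandReal, uHat_linear hu hv, integrandReal, integrandReal]
    ring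
  have e2 : (∫ σ : ℝ, kern (coefPlus fun x => a * u x + v x) fluxPlus j x t (σ + Complex.I))
      = a * (∫ σ : ℝ, kern (coefPlus u) fluxPlus 0 x t (σ + Complex.I))
        + ∫ σ : ℝ, kern (coefPlus v) fluxPlus j x t (σ + Complex.I) := by
    rw [← integral_const_mul, ← integral_add
      ((integrable_kern (holoBounded_coefPlus hu) holoBounded_fluxPlus hx.1 ht hK0 h0).const_mul _)
      (integrable_kern (holoBounded_coefPlus hv) holoBounded_fluxPlus hx.1 ht hK hj)]
    congr 1
    ext σ
    simp only [kern, coefPlus, uHat_linear hu hv, duhamel_zero]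
    ring
  have e3 : (∫ σ : ℝ, kern (coefMinus fun x => a * u x + v x) fluxMinus j (1 - x) t (σ + Complex.I))
      = a * (∫ σ : ℝ, kern (coefMinus u) fluxMinus 0 (1 - x) t (σ + Complex.I))
        + ∫ σ : ℝ, kern (coefMinus v) fluxMinus j (1 - x) t (σ + Complex.I) := by
    rw [← integral_const_mul, ← integral_add
      ((integrable_kern (holoBounded_coefMinus hu) holoBounded_fluxMinus hx' ht hK0 h0).const_mul _)
      (integrable_kern (holoBounded_coefMinus hv) holoBounded_fluxMinus hx' ht hK hj)]
    congr 1
    ext σ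
    simp only [kern, coefMinus, uHat_linear hu hv, duhamel_zero]
    ring
  rw [lineSolution, lineSolution, lineSolution, e1, e2, e3]
  ring

lemma norm_one_div_two_pi_le : ‖(1 / (2 * (Real.pi : ℂ)))‖ ≤ 1 := by
  rw [norm_div, norm_mul, Complex.norm_real, Real.norm_of_nonneg Real.pi_pos.le]
  simp only [norm_one, Complex.norm_ofNat]
  rw [div_le_one (by positivity)]
  linarith [Real.pi_gt_three]

lemma sq_re_line (σ v : ℝ) : ((σ + v * Complex.I : ℂ) ^ 2).re = σ ^ 2 - v ^ 2 := by
  rw [pow_two, Complex.mul_re]; simp; ring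

lemma norm_exp_line_le_one {y v : ℝ} (hy : 0 ≤ y) (hv : 0 ≤ v) (σ : ℝ) :
    ‖Complex.exp (Complex.I * (σ + v * Complex.I) * y)‖ ≤ 1 := by
  rw [Complex.norm_exp]
  refine Real.exp_le_one_iff.2 ?_
  have : (Complex.I * (σ + v * Complex.I) * y).re = -(v * y) := by simp
  rw [this]
  nlinarith [mul_nonneg hv hy]

/-- The substitution σ√t gives the value 2π√t; only the limit is needed. For t < 1 the integrand is
dominated by 2/(1 + σ²). -/
lemma tendsto_integral_two_mul_div :
    Tendsto (fun t : ℝ => ∫ σ : ℝ, 2 * t / (1 + t * σ ^ 2)) (𝓝[>] 0) (𝓝 0) := by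
  have h : Tendsto (fun t : ℝ => ∫ σ : ℝ, 2 * t / (1 + t * σ ^ 2)) (𝓝[>] 0)
      (𝓝 (∫ _ : ℝ, (0 : ℝ))) := by
    refine tendsto_integral_filter_of_dominated_convergence (fun σ => 2 / (1 + σ ^ 2)) ?_ ?_
      (integrable_const_div_one_add_sq 2) ?_
    · filter_upwards [self_mem_nhdsWithin] with t ht
      have ht : 0 < t := ht
      exact (Continuous.div (by fun_prop) (by fun_prop)
        fun σ => by positivity).aestronglyMeasurable
    · filter_upwards [Ioo_mem_nhdsGT one_pos] with t ht
      refine ae_of_all _ fun σ => ?_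
      have ht0 : 0 < t := ht.1
      rw [Real.norm_of_nonneg (by positivity), div_le_div_iff₀ (by positivity) (by positivity)]
      nlinarith [ht.2, mul_nonneg ht0.le (sq_nonneg σ)]
    · refine ae_of_all _ fun σ => ?_
      have hc : ContinuousAt (fun t : ℝ => 2 * t / (1 + t * σ ^ 2)) 0 :=
        ContinuousAt.div (by fun_prop) (by fun_prop) (by simp)
      simpa using hc.tendsto.mono_left nhdsWithin_le_nhds
  simpa using h

lemma integrable_two_mul_div {t : ℝ} (ht : 0 < t) :
    Integrable fun σ : ℝ => 2 * t / (1 + t * σ ^ 2) := by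
  refine (integrable_const_div_one_add_sq (2 * t * (1 + 1 / t))).mono' ?_ (ae_of_all _ fun σ => ?_)
  · exact (Continuous.div (by fun_prop) (by fun_prop) fun σ => by positivity).aestronglyMeasurable
  · rw [Real.norm_of_nonneg (by positivity)]
    calc 2 * t / (1 + t * σ ^ 2) = 2 * t * (1 / (1 + t * σ ^ 2)) := by ring
      _ ≤ 2 * t * ((1 + 1 / t) / (1 + σ ^ 2)) :=
          mul_le_mul_of_nonneg_left (one_div_one_add_mul_sq_le ht σ) (by positivity)
      _ = _ := by ring

/-- On Im z = 1 the exponential e^{izy} is at most one, and |e^{-z²τ}| ≤ e·e^{-σ²τ} for τ ≤ 1. The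
Duhamel bound then requires nothing of j beyond its size, and the result is uniform in y. -/
lemma norm_integral_kern_flux_le {N : ℂ → ℂ} {j : ℝ → ℝ} {y t K C : ℝ} (hy : 0 ≤ y) (ht : 0 < t)
    (ht1 : t ≤ 1) (hK : ∀ s ∈ Icc 0 t, |j s| ≤ K) (hC : ∀ z : ℂ, 1 ≤ z.im → ‖N z‖ ≤ C) :
    ‖∫ σ : ℝ, kern (fun _ => 0) N j y t (σ + Complex.I)‖
      ≤ C * (Real.exp 1 * K) * ∫ σ : ℝ, 2 * t / (1 + t * σ ^ 2) := by
  have hC0 : 0 ≤ C := (norm_nonneg _).trans (hC Complex.I (by simp))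
  rw [← integral_const_mul]
  refine norm_integral_le_of_norm_le ((integrable_two_mul_div ht).const_mul _)
    (ae_of_all _ fun σ => ?_)
  have hE := norm_exp_line_le_one hy zero_le_one σ
  have hre := sq_re_line σ 1
  simp only [Complex.ofReal_one, one_mul] at hE hre
  have h := mul_norm_duhamel_le (j := j) (E := 1) (A := Real.exp 1) (κ := σ ^ 2)
    (z := σ + Complex.I) ht.le (sq_nonneg σ) (Real.exp_pos _).le zero_le_one hK (fun τ hτ => by
      rw [one_mul, ← Real.exp_add, hre]
      refine Real.exp_le_exp.2 ?_
      nlinarith [hτ.2])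
  have hN := hC (σ + Complex.I) (by simp)
  rw [kern, mul_zero, zero_add, norm_mul, norm_mul]
  rw [one_mul] at h
  calc _ ≤ 1 * (C * (Real.exp 1 * K * (2 * t / (1 + t * σ ^ 2)))) := by gcongr
    _ = _ := by ring

lemma coefPlus_zero : coefPlus (fun _ => 0) = fun _ => 0 := by
  ext z; simp [coefPlus, uHat]

lemma coefMinus_zero : coefMinus (fun _ => 0) = fun _ => 0 := by
  ext z; simp [coefMinus, uHat]

/-- The contribution of the boundary data is uniformly small for small times. -/
lemma exists_norm_lineSolution_flux_le {j : ℝ → ℝ} {K : ℝ}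
    (hK : ∀ s ∈ Icc (0 : ℝ) 1, |j s| ≤ K) :
    ∃ g : ℝ → ℝ, Tendsto g (𝓝[>] 0) (𝓝 0) ∧ ∀ t ∈ Ioc (0 : ℝ) 1, ∀ x ∈ Icc (0 : ℝ) 1,
      ‖lineSolution (fun _ => 0) j x t‖ ≤ g t := by
  obtain ⟨C, -, hC⟩ := exists_norm_coef_le one_pos
  refine ⟨fun t => 2 * (C * (Real.exp 1 * K)) * ∫ σ : ℝ, 2 * t / (1 + t * σ ^ 2), ?_, ?_⟩
  · simpa using tendsto_integral_two_mul_div.const_mul (2 * (C * (Real.exp 1 * K)))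
  intro t ht x hx
  have hK' : ∀ s ∈ Icc (0 : ℝ) t, |j s| ≤ K := fun s hs => hK s ⟨hs.1, hs.2.trans ht.2⟩
  have h1 := norm_integral_kern_flux_le hx.1 ht.1 ht.2 hK' (fun z hz => (hC z hz).1)
  have h2 := norm_integral_kern_flux_le (sub_nonneg.2 hx.2) ht.1 ht.2 hK'
    (fun z hz => (hC z hz).2.1)
  have h0 : ∀ l : ℝ, integrandReal (fun _ => 0) x t l = 0 := fun l => by simp [integrandReal, uHat]
  rw [lineSolution, coefPlus_zero, coefMinus_zero, norm_mul]
  simp only [h0, integral_zero, zero_sub]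
  calc _ ≤ 1 * (‖-∫ σ : ℝ, kern (fun _ => 0) fluxPlus j x t (σ + Complex.I)‖
      + ‖∫ σ : ℝ, kern (fun _ => 0) fluxMinus j (1 - x) t (σ + Complex.I)‖) :=
        mul_le_mul norm_one_div_two_pi_le (norm_add_le _ _) (norm_nonneg _) zero_le_one
    _ ≤ _ := by rw [norm_neg]; linarith

/-! ### Initial values vanishing at both end points -/

/-- Measures the cost of replacing e^{-z²t} by 1 against a quadratically decaying factor. It is used
with v = 0 for the real integral and v = 1 for the two contour integrals. -/
lemma tendsto_integral_exp_sub_one (v C : ℝ) :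
    Tendsto (fun t : ℝ => ∫ σ : ℝ,
      ‖Complex.exp (-((σ + v * Complex.I) ^ 2 * t)) - 1‖ * (C / (1 + σ ^ 2))) (𝓝[>] 0) (𝓝 0) := by
  have h : Tendsto (fun t : ℝ => ∫ σ : ℝ,
      ‖Complex.exp (-((σ + v * Complex.I) ^ 2 * t)) - 1‖ * (C / (1 + σ ^ 2))) (𝓝[>] 0)
      (𝓝 (∫ _ : ℝ, (0 : ℝ))) := by
    refine tendsto_integral_filter_of_dominated_convergence
      (fun σ => (Real.exp (v ^ 2) + 1) * (|C| / (1 + σ ^ 2))) ?_ ?_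
      ((integrable_const_div_one_add_sq |C|).const_mul _) ?_
    · refine Eventually.of_forall fun t => Continuous.aestronglyMeasurable ?_
      exact Continuous.mul (by fun_prop)
        (Continuous.div (by fun_prop) (by fun_prop) fun σ => by positivity)
    · filter_upwards [Ioo_mem_nhdsGT one_pos] with t ht
      refine ae_of_all _ fun σ => ?_
      rw [norm_mul, norm_norm, norm_div, Real.norm_eq_abs C,
        Real.norm_of_nonneg (show 0 ≤ 1 + σ ^ 2 by positivity)]
      gcongr
      refine (norm_sub_le _ _).trans ?_
      rw [norm_one, Complex.norm_exp, Complex.neg_re, Complex.re_mul_ofReal, sq_re_line]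
      gcongr
      nlinarith [ht.1, ht.2, sq_nonneg σ, sq_nonneg v, mul_nonneg ht.1.le (sq_nonneg σ)]
    · refine ae_of_all _ fun σ => ?_
      have hc : Continuous fun t : ℝ =>
          ‖Complex.exp (-((σ + v * Complex.I) ^ 2 * t)) - 1‖ * (C / (1 + σ ^ 2)) := by fun_prop
      simpa using (hc.tendsto 0).mono_left nhdsWithin_le_nhds
  simpa using h

lemma integrable_exp_sub_one {t : ℝ} (ht : 0 < t) (v C : ℝ) : Integrable fun σ : ℝ =>
    ‖Complex.exp (-((σ + v * Complex.I) ^ 2 * t)) - 1‖ * (C / (1 + σ ^ 2)) := by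
  refine ((integrable_const_div_one_add_sq |C|).const_mul (Real.exp (v ^ 2 * t) + 1)).mono' ?_
    (ae_of_all _ fun σ => ?_)
  · refine Continuous.aestronglyMeasurable ?_
    exact Continuous.mul (by fun_prop)
        (Continuous.div (by fun_prop) (by fun_prop) fun σ => by positivity)
  · rw [norm_mul, norm_norm, norm_div, Real.norm_eq_abs C,
        Real.norm_of_nonneg (show 0 ≤ 1 + σ ^ 2 by positivity)]
    gcongr
    refine (norm_sub_le _ _).trans ?_
    rw [norm_one, Complex.norm_exp, Complex.neg_re, Complex.re_mul_ofReal, sq_re_line]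
    gcongr
    nlinarith [mul_nonneg ht.le (sq_nonneg σ)]

lemma norm_line_sq (σ v : ℝ) : ‖(σ + v * Complex.I : ℂ)‖ ^ 2 = σ ^ 2 + v ^ 2 := by
  rw [Complex.sq_norm, Complex.normSq_add_mul_I]

/-- A line integral of a holomorphic function with quadratic decay in a half-plane vanishes. -/
lemma integral_line_eq_zero {M : ℂ → ℂ} {C y : ℝ} (hy : 0 ≤ y)
    (hd : ∀ z : ℂ, 0 < z.im → DifferentiableAt ℂ M z)
    (hC : ∀ z : ℂ, 1 ≤ z.im → ‖z‖ ^ 2 * ‖M z‖ ≤ C) :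
    (Integrable fun σ : ℝ => Complex.exp (Complex.I * (σ + Complex.I) * y) * M (σ + Complex.I)) ∧
      ∫ σ : ℝ, Complex.exp (Complex.I * (σ + Complex.I) * y) * M (σ + Complex.I) = 0 := by
  set f : ℂ → ℂ := fun z => Complex.exp (Complex.I * z * y) * M z with hf
  have hC0 : 0 ≤ C := (by positivity : 0 ≤ ‖Complex.I‖ ^ 2 * ‖M Complex.I‖).trans
    (hC Complex.I (by simp))
  have hfd : ∀ z : ℂ, 0 < z.im → DifferentiableAt ℂ f z := fun z hz =>
    DifferentiableAt.mul (by fun_prop) (hd z hz)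
  have hle : ∀ σ v : ℝ, 1 ≤ v → ‖f (σ + v * Complex.I)‖ ≤ C / (σ ^ 2 + v ^ 2) := by
    intro σ v hv
    have h1 := norm_exp_line_le_one hy (zero_le_one.trans hv) σ
    have h2 := hC (σ + v * Complex.I) (by simpa using hv)
    rw [norm_line_sq] at h2
    rw [hf, le_div_iff₀ (by positivity), norm_mul]
    calc _ ≤ 1 * ‖M (σ + v * Complex.I)‖ * (σ ^ 2 + v ^ 2) := by gcongr
      _ ≤ C := by linarith
  have hle' : ∀ σ v : ℝ, 1 ≤ v → ‖f (σ + v * Complex.I)‖ ≤ C / (1 + σ ^ 2) := by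
    intro σ v hv
    refine (hle σ v hv).trans ?_
    exact div_le_div_of_nonneg_left hC0 (by positivity) (by nlinarith)
  have hsh : ∀ v : ℝ, 1 ≤ v → (Integrable fun σ : ℝ => f (σ + v * Complex.I)) ∧
      ∫ σ : ℝ, f (σ + (1 : ℝ) * Complex.I) = ∫ σ : ℝ, f (σ + v * Complex.I) := by
    intro v hv
    have := integral_horizontal_line_eq_of_decay hv
      (fun z hz => hfd z (zero_lt_one.trans_le hz.1)) (fun σ w hw => hle' σ w hw.1)
    exact ⟨this.1 v ⟨hv, le_rfl⟩, this.2⟩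
  -- The integral does not depend on the height v ≥ 1, and the bound C/(σ² + v²) sends it to zero as
  -- v → ∞. No decay of e^{izy} is used, so y = 0 is allowed.
  have hlim : Tendsto (fun v : ℝ => ∫ σ : ℝ, f (σ + v * Complex.I)) atTop
      (𝓝 (∫ _ : ℝ, (0 : ℂ))) := by
    refine tendsto_integral_filter_of_dominated_convergence (fun σ => C / (1 + σ ^ 2)) ?_ ?_
      (integrable_const_div_one_add_sq C) ?_
    · filter_upwards [eventually_ge_atTop 1] with v hv
      exact (hsh v hv).1.aestronglyMeasurable
    · filter_upwards [eventually_ge_atTop 1] with v hv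
      exact ae_of_all _ fun σ => hle' σ v hv
    · refine ae_of_all _ fun σ => ?_
      have h0 : Tendsto (fun v : ℝ => C / (1 + v ^ 2) * 2) atTop (𝓝 0) := by
        simpa using (tendsto_const_div_one_add_sq_atTop C).mul_const 2
      refine squeeze_zero_norm' ?_ h0
      filter_upwards [eventually_ge_atTop 1] with v hv
      refine (hle σ v hv).trans ?_
      rw [div_mul_eq_mul_div, div_le_div_iff₀ (by positivity) (by positivity)]
      have : C * (1 + v ^ 2) ≤ C * (2 * (σ ^ 2 + v ^ 2)) := by
        gcongr
        nlinarith [sq_nonneg σ]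
      linarith
  rw [integral_zero] at hlim
  have hconst := hlim.congr' (f₂ := fun _ => ∫ σ : ℝ, f (σ + (1 : ℝ) * Complex.I)) (by
    filter_upwards [eventually_ge_atTop 1] with v hv using (hsh v hv).2.symm)
  have hz := tendsto_nhds_unique tendsto_const_nhds hconst
  have hi := (hsh 1 le_rfl).1
  simp only [Complex.ofReal_one, one_mul] at hz hi
  exact ⟨hi, hz⟩

lemma integral_eq_zero_of_odd {f : ℝ → ℂ} (hf : ∀ x, f (-x) = -f x) : ∫ x, f x = 0 := by
  have h := integral_neg_eq_self f volume
  simp only [hf, integral_neg] at h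
  exact self_eq_neg.1 h.symm

/-- Decay of the transform on the imaginary axis and in the left half-plane. -/
lemma exists_norm_uHat_le_div {w : ℝ → ℝ} (hw : ContDiffOn ℝ 2 w (Icc 0 1)) (h0 : w 0 = 0)
    (h1 : w 1 = 0) :
    ∃ C : ℝ, ∀ l : ℝ, ‖uHat w (-(Complex.I * l))‖ ≤ C / (1 + l ^ 2) := by
  obtain ⟨U, hU⟩ := exists_norm_uHat_le hw.continuousOn
  obtain ⟨K, hK⟩ := exists_norm_uHat_mul_sq_le hw h0 h1
  refine ⟨U + K, fun l => ?_⟩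
  have a1 := hU (-(Complex.I * l)) (by simp)
  have a2 := hK (-(Complex.I * l)) (by simp)
  rw [norm_neg, norm_mul, Complex.norm_I, one_mul, Complex.norm_real, Real.norm_eq_abs,
    sq_abs] at a2
  rw [le_div_iff₀ (by positivity)]
  linarith

open FourierTransform in
/-- Fourier inversion for functions on `[0, 1]` vanishing at the end points. -/
lemma integral_integrandReal_zero {w : ℝ → ℝ} (hw : ContDiffOn ℝ 2 w (Icc 0 1)) (h0 : w 0 = 0)
    (h1 : w 1 = 0) {x : ℝ} (hx : x ∈ Icc (0 : ℝ) 1) :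
    ∫ l : ℝ, integrandReal w x 0 l = 2 * Real.pi * w x := by
  set W : ℝ → ℂ := (Icc (0 : ℝ) 1).indicator fun y => (w y : ℂ) with hW
  -- Vanishing at 0 and 1 makes the extension by zero continuous, so inversion holds at every point
  -- of [0, 1], the end points included.
  have hWc : Continuous W := by
    refine continuous_indicator (fun a ha => ?_) ?_
    · rw [frontier_Icc zero_le_one] at ha
      rcases ha with rfl | rfl
      · simp [h0]
      · simp [h1]
    · rw [isClosed_Icc.closure_eq]
      exact Complex.continuous_ofReal.comp_continuousOn hw.continuousOn
  have hWi : Integrable W := by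
    refine (integrable_indicator_iff measurableSet_Icc).2 (ContinuousOn.integrableOn_Icc ?_)
    exact Complex.continuous_ofReal.comp_continuousOn hw.continuousOn
  -- The frequencies are related by λ = 2πξ; this scaling produces the factor 2π.
  have hF : ∀ ξ : ℝ, 𝓕 W ξ = uHat w (-(Complex.I * (2 * Real.pi * ξ : ℝ))) := by
    intro ξ
    rw [Real.fourier_real_eq_integral_exp_smul, uHat, intervalIntegral.integral_of_le zero_le_one,
      ← integral_Icc_eq_integral_Ioc, ← integral_indicator measurableSet_Icc]
    congr 1
    ext y
    rw [hW]
    by_cases hy : y ∈ Icc (0 : ℝ) 1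
    · rw [indicator_of_mem hy, indicator_of_mem hy, smul_eq_mul]
      congr 2
      push_cast
      ring
    · rw [indicator_of_notMem hy, indicator_of_notMem hy, smul_zero]
  obtain ⟨C, hC⟩ := exists_norm_uHat_le_div hw h0 h1
  have hcont : Continuous fun l : ℝ => uHat w (-(Complex.I * l)) := by
    have := (differentiable_uHat hw.continuousOn).continuous
    fun_prop
  have hint : Integrable fun l : ℝ => uHat w (-(Complex.I * l)) :=
    (integrable_const_div_one_add_sq C).mono' hcont.aestronglyMeasurable (ae_of_all _ hC)
  have h2π : (2 * Real.pi : ℝ) ≠ 0 := by positivity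
  have hFi : Integrable (𝓕 W) := by
    have := hint.comp_mul_left' h2π
    refine this.congr (ae_of_all _ fun ξ => ?_)
    simp only [hF]
  have hinv := congrFun (hWc.fourierInv_fourier_eq hWi hFi) x
  rw [Real.fourierInv_eq'] at hinv
  have hWx : W x = w x := indicator_of_mem hx _
  rw [hWx] at hinv
  have hsub := Measure.integral_comp_mul_left (fun l : ℝ => integrandReal w x 0 l) (2 * Real.pi)
  have hcomp : (∫ ξ : ℝ, integrandReal w x 0 ((2 * Real.pi * ξ : ℝ) : ℂ)) = w x := by
    rw [← hinv]
    congr 1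
    ext ξ
    rw [hF, integrandReal, elem, smul_eq_mul]
    congr 2
    simp
    ring
  rw [hcomp, abs_of_pos (by positivity), Complex.real_smul] at hsub
  rw [hsub]
  push_cast
  have : (Real.pi : ℂ) ≠ 0 := by exact_mod_cast Real.pi_ne_zero
  field_simp

lemma kern_zero_flux (M N : ℂ → ℂ) (y t : ℝ) (z : ℂ) :
    kern M N 0 y t z = Complex.exp (Complex.I * z * y) * (Complex.exp (-(z ^ 2 * t)) * M z) := by
  rw [kern, duhamel_zero, mul_zero, add_zero]

/-- The general coefficient bound with B of size |z|⁻². The term with e^{iz}û(-iz) is the transform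
of the reflected function, which also vanishes at both ends. -/
lemma exists_norm_coef_mul_sq_le {w : ℝ → ℝ} (hw : ContDiffOn ℝ 2 w (Icc 0 1)) (h0 : w 0 = 0)
    (h1 : w 1 = 0) : ∃ C : ℝ, ∀ z : ℂ, 1 ≤ z.im →
      ‖z‖ ^ 2 * ‖coefPlus w z‖ ≤ C ∧ ‖z‖ ^ 2 * ‖coefMinus w z‖ ≤ C := by
  obtain ⟨C, hC0, hC⟩ := exists_norm_coef_le one_pos
  obtain ⟨K, hK⟩ := exists_norm_uHat_mul_sq_le hw h0 h1
  have hw' : ContDiffOn ℝ 2 (fun x => w (1 - x)) (Icc 0 1) :=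
    hw.comp (contDiff_const.sub contDiff_id).contDiffOn
      fun x hx => ⟨by linarith [hx.2], by linarith [hx.1]⟩
  obtain ⟨K', hK'⟩ := exists_norm_uHat_mul_sq_le hw' (by simpa using h1) (by simpa using h0)
  refine ⟨C * max K K', fun z hz => ?_⟩
  have hz0 : 0 < ‖z‖ ^ 2 := by
    have := (hz.trans (le_abs_self _)).trans (Complex.abs_im_le_norm z)
    positivity
  have hre : (Complex.I * z).re ≤ 0 := by simp; linarith
  have hn : ‖Complex.I * z‖ = ‖z‖ := by simp
  have a1 := hK _ hre
  have a2 := hK' _ hre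
  rw [hn] at a1 a2
  have := (hC z hz).2.2 w (max K K' / ‖z‖ ^ 2)
    (by rw [le_div_iff₀ hz0, mul_comm]; exact a1.trans (le_max_left _ _))
    (by rw [le_div_iff₀ hz0, mul_comm, exp_mul_uHat_neg]; exact a2.trans (le_max_right _ _))
  have he : ‖z‖ ^ 2 * (C * (max K K' / ‖z‖ ^ 2)) = C * max K K' := by
    rw [mul_left_comm, mul_div_cancel₀ _ hz0.ne']
  exact ⟨(mul_le_mul_of_nonneg_left this.1 hz0.le).trans he.le,
    (mul_le_mul_of_nonneg_left this.2 hz0.le).trans he.le⟩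

/-- The same integral with t = 0 vanishes by closing upwards. Subtracting it leaves the factor
e^{-z²t} - 1, and y disappears from the bound. -/
lemma norm_integral_kern_zero_flux_le {M N : ℂ → ℂ} {C y t : ℝ} (hy : 0 ≤ y) (ht : 0 < t)
    (hM : HoloBounded M) (hN : HoloBounded N) (hC : ∀ z : ℂ, 1 ≤ z.im → ‖z‖ ^ 2 * ‖M z‖ ≤ C) :
    ‖∫ σ : ℝ, kern M N 0 y t (σ + Complex.I)‖
      ≤ ∫ σ : ℝ, ‖Complex.exp (-((σ + (1 : ℝ) * Complex.I) ^ 2 * t)) - 1‖ * (C / (1 + σ ^ 2)) := by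
  obtain ⟨hi, hz⟩ := integral_line_eq_zero hy hM.1 hC
  have hk := integrable_kern (j := 0) (K := 0) hM hN hy ht (by simp) intervalIntegrable_const
  rw [← sub_zero (∫ σ : ℝ, kern M N 0 y t (σ + Complex.I)), ← hz, ← integral_sub hk hi]
  refine norm_integral_le_of_norm_le (integrable_exp_sub_one ht 1 C) (ae_of_all _ fun σ => ?_)
  have h1 := norm_exp_line_le_one hy zero_le_one σ
  have h2 := hC (σ + (1 : ℝ) * Complex.I) (by simp)
  rw [norm_line_sq] at h2
  simp only [Complex.ofReal_one, one_mul] at h1 h2 ⊢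
  rw [kern_zero_flux, ← mul_sub, ← sub_one_mul, norm_mul, norm_mul]
  have h3 : ‖M (σ + Complex.I)‖ ≤ C / (1 + σ ^ 2) := by
    rw [le_div_iff₀ (by positivity)]; linarith
  calc _ ≤ 1 * (‖Complex.exp (-((σ + Complex.I) ^ 2 * t)) - 1‖ * (C / (1 + σ ^ 2))) := by gcongr
    _ = _ := one_mul _

/-- Uniform attainment of initial values vanishing at both end points. -/
lemma exists_norm_lineSolution_sub_le {w : ℝ → ℝ} (hw : ContDiffOn ℝ 2 w (Icc 0 1)) (h0 : w 0 = 0)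
    (h1 : w 1 = 0) :
    ∃ g : ℝ → ℝ, Tendsto g (𝓝[>] 0) (𝓝 0) ∧ ∀ t : ℝ, 0 < t → ∀ x ∈ Icc (0 : ℝ) 1,
      ‖lineSolution w 0 x t - w x‖ ≤ g t := by
  obtain ⟨C, hC⟩ := exists_norm_coef_mul_sq_le hw h0 h1
  obtain ⟨U, hU⟩ := exists_norm_uHat_le_div hw h0 h1
  have hwc := hw.continuousOn
  refine ⟨fun t => (∫ σ : ℝ, ‖Complex.exp (-((σ + (0 : ℝ) * Complex.I) ^ 2 * t)) - 1‖
      * (U / (1 + σ ^ 2)))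
    + (∫ σ : ℝ, ‖Complex.exp (-((σ + (1 : ℝ) * Complex.I) ^ 2 * t)) - 1‖ * (C / (1 + σ ^ 2)))
    + ∫ σ : ℝ, ‖Complex.exp (-((σ + (1 : ℝ) * Complex.I) ^ 2 * t)) - 1‖ * (C / (1 + σ ^ 2)),
    ?_, fun t ht x hx => ?_⟩
  · simpa using ((tendsto_integral_exp_sub_one 0 U).add (tendsto_integral_exp_sub_one 1 C)).add
      (tendsto_integral_exp_sub_one 1 C)
  have hp := norm_integral_kern_zero_flux_le hx.1 ht (holoBounded_coefPlus hwc)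
    holoBounded_fluxPlus fun z hz => (hC z hz).1
  have hm := norm_integral_kern_zero_flux_le (sub_nonneg.2 hx.2) ht (holoBounded_coefMinus hwc)
    holoBounded_fluxMinus fun z hz => (hC z hz).2
  have hnorm : ∀ l : ℝ, ‖Complex.exp (Complex.I * l * x)‖ = 1 := by
    intro l
    rw [show Complex.I * l * x = ((l * x : ℝ) : ℂ) * Complex.I by push_cast; ring,
      Complex.norm_exp_ofReal_mul_I]
  have hi0 : Integrable fun l : ℝ => integrandReal w x 0 l := by
    refine (integrable_const_div_one_add_sq U).mono'
      (continuous_integrandReal_right hwc x 0).aestronglyMeasurable (ae_of_all _ fun l => ?_)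
    rw [integrandReal, elem_eq, norm_mul, norm_mul, hnorm]
    simpa using hU l
  have hr : ‖(∫ l : ℝ, integrandReal w x t l) - 2 * Real.pi * w x‖
      ≤ ∫ σ : ℝ, ‖Complex.exp (-((σ + (0 : ℝ) * Complex.I) ^ 2 * t)) - 1‖ * (U / (1 + σ ^ 2)) := by
    rw [← integral_integrandReal_zero hw h0 h1 hx, ← integral_sub
      (integrable_integrandReal hwc x ht) hi0]
    refine norm_integral_le_of_norm_le (integrable_exp_sub_one ht 0 U) (ae_of_all _ fun l => ?_)
    have e : integrandReal w x t l - integrandReal w x 0 l = Complex.exp (Complex.I * l * x)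
        * ((Complex.exp (-((l : ℂ) ^ 2 * t)) - 1) * uHat w (-(Complex.I * l))) := by
      rw [integrandReal, integrandReal, elem_eq, elem_eq]
      simp
      ring
    rw [e, norm_mul, norm_mul, hnorm, one_mul]
    simp only [Complex.ofReal_zero, zero_mul, add_zero]
    gcongr
    exact hU l
  have hsplit : lineSolution w 0 x t - w x = 1 / (2 * (Real.pi : ℂ)) *
      (((∫ l : ℝ, integrandReal w x t l) - 2 * Real.pi * w x)
        - (∫ σ : ℝ, kern (coefPlus w) fluxPlus 0 x t (σ + Complex.I))
        + ∫ σ : ℝ, kern (coefMinus w) fluxMinus 0 (1 - x) t (σ + Complex.I)) := by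
    have : (Real.pi : ℂ) ≠ 0 := by exact_mod_cast Real.pi_ne_zero
    rw [lineSolution]
    field_simp
    ring
  rw [hsplit, norm_mul]
  refine (mul_le_mul norm_one_div_two_pi_le ((norm_add_le _ _).trans
    (add_le_add ((norm_sub_le _ _).trans (add_le_add hr hp)) hm)) (norm_nonneg _)
    zero_le_one).trans (le_of_eq (one_mul _))

/-! ### The stationary initial value x -/

lemma uHat_id {w : ℂ} (hw : w ≠ 0) :
    uHat (fun x => x) w = Complex.exp w / w - (Complex.exp w - 1) / w ^ 2 := by
  have h1 := mul_uHat (f := fun x => x) (f' := fun _ => 1) (by fun_prop) (by fun_prop)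
    (fun x _ => hasDerivAt_id' x) w
  have h2 := mul_uHat (f := fun _ => 1) (f' := fun _ => 0) (by fun_prop) (by fun_prop)
    (fun x _ => hasDerivAt_const x 1) w
  have h3 : uHat (fun _ => 0) w = 0 := by simp [uHat]
  rw [h3] at h2
  push_cast at h1 h2
  field_simp
  linear_combination w * h1 - h2

/-- The function x vanishes at 0 and satisfies x' - x = 0 at 1. Hence the numerator is a multiple of
Δ, and every pole except the origin cancels. -/
lemma coefPlus_id {z : ℂ} (hz : 0 < z.im) : coefPlus (fun x => x) z = -(1 / z ^ 2) := by
  have hz0 : z ≠ 0 := by rintro rfl; simp at hz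
  have hI := Complex.I_ne_zero
  have hΔ := Delta_ne_zero hz
  have hE : Complex.exp (Complex.I * z) ≠ 0 := Complex.exp_ne_zero _
  rw [coefPlus, uHat_id (mul_ne_zero hI hz0), uHat_id (neg_ne_zero.2 (mul_ne_zero hI hz0)),
    div_eq_iff hΔ, Delta]
  have hm : Complex.exp (-(Complex.I * z)) = 1 / Complex.exp (Complex.I * z) := by
    rw [Complex.exp_neg, one_div]
  rw [hm, neg_sq, mul_pow, Complex.I_sq]
  field_simp
  ring_nf
  simp only [Complex.I_sq]
  ring

lemma coefMinus_id {z : ℂ} (hz : 0 < z.im) :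
    coefMinus (fun x => x) z = -((1 - Complex.I * z) / z ^ 2) := by
  have hz0 : z ≠ 0 := by rintro rfl; simp at hz
  have hI := Complex.I_ne_zero
  have hΔ := Delta_ne_zero hz
  have hE : Complex.exp (Complex.I * z) ≠ 0 := Complex.exp_ne_zero _
  rw [coefMinus, uHat_id (mul_ne_zero hI hz0), uHat_id (neg_ne_zero.2 (mul_ne_zero hI hz0)),
    div_eq_iff hΔ, Delta]
  have hm : Complex.exp (-(Complex.I * z)) = 1 / Complex.exp (Complex.I * z) := by
    rw [Complex.exp_neg, one_div]
  rw [hm, neg_sq, mul_pow, Complex.I_sq]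
  field_simp
  ring_nf
  simp only [Complex.I_sq, Complex.I_pow_three]
  ring

/-- The regular part of the integrand belonging to the stationary solution `x`. -/
def regularPart (x : ℝ) (z : ℂ) : ℂ :=
  -∫ y in (0 : ℝ)..(1 - x), ((y + x : ℝ) : ℂ) * Complex.sin (z * y)

/-- The closed form has an apparent singularity at the origin. The defining integral shows that it
is removable and that the function is entire and odd. -/
lemma regularPart_eq {x : ℝ} {z : ℂ} (hz : z ≠ 0) :
    regularPart x z = (z * Complex.cos (z * (1 - x)) - Complex.sin (z * (1 - x)) - x * z) / z ^ 2 := by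
  have h := intervalIntegral.integral_eq_sub_of_hasDerivAt (a := 0) (b := 1 - x)
    (f := fun y : ℝ => -(((y + x : ℝ) : ℂ) * Complex.cos (z * y)) / z + Complex.sin (z * y) / z ^ 2)
    (f' := fun y : ℝ => ((y + x : ℝ) : ℂ) * Complex.sin (z * y)) (fun y _ => by
      have h1 : HasDerivAt (fun w : ℂ => z * w) (z * 1) (y : ℂ) :=
        (hasDerivAt_id (y : ℂ)).const_mul z
      have h2 : HasDerivAt (fun y : ℝ => ((y + x : ℝ) : ℂ)) ((1 : ℝ) : ℂ) y :=
        ((hasDerivAt_id y).add_const x).ofReal_comp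
      have h3 := (((h2.mul h1.ccos.comp_ofReal).neg).div_const z).add
        (h1.csin.comp_ofReal.div_const (z ^ 2))
      refine h3.congr_deriv ?_
      field_simp
      push_cast
      ring) (Continuous.intervalIntegrable (by fun_prop) _ _)
  rw [regularPart, h]
  push_cast
  simp only [mul_zero, Complex.cos_zero, Complex.sin_zero]
  field_simp
  ring

lemma regularPart_neg (x : ℝ) (z : ℂ) : regularPart x (-z) = -regularPart x z := by
  simp only [regularPart, neg_mul, Complex.sin_neg, mul_neg, intervalIntegral.integral_neg]

lemma norm_sin_le (z : ℂ) : ‖Complex.sin z‖ ≤ Real.exp |z.im| := by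
  rw [Complex.sin, norm_div, norm_mul, Complex.norm_I, mul_one, Complex.norm_ofNat,
    div_le_iff₀ two_pos]
  refine (norm_sub_le _ _).trans ?_
  rw [Complex.norm_exp, Complex.norm_exp]
  have h1 : (-z * Complex.I).re ≤ |z.im| := by simpa using le_abs_self z.im
  have h2 : (z * Complex.I).re ≤ |z.im| := by simpa using neg_le_abs z.im
  linarith [Real.exp_le_exp.2 h1, Real.exp_le_exp.2 h2]

lemma norm_regularPart_le {x : ℝ} (hx : x ∈ Icc (0 : ℝ) 1) {z : ℂ} (hz : |z.im| ≤ 1) :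
    ‖regularPart x z‖ ≤ Real.exp 1 := by
  have h := intervalIntegral.norm_integral_le_of_norm_le_const (a := 0) (b := 1 - x)
    (f := fun y : ℝ => ((y + x : ℝ) : ℂ) * Complex.sin (z * y)) (C := Real.exp 1) (fun y hy => by
      rw [uIoc_of_le (by linarith [hx.2])] at hy
      rw [norm_mul, Complex.norm_real, Real.norm_eq_abs, abs_of_nonneg (by linarith [hy.1, hx.1])]
      have h1 := norm_sin_le (z * y)
      have h2 : |(z * y).im| ≤ 1 := by
        rw [Complex.im_mul_ofReal, abs_mul, abs_of_pos hy.1]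
        nlinarith [abs_nonneg z.im, hy.1, hy.2, hx.1]
      calc (y + x) * ‖Complex.sin (z * y)‖ ≤ 1 * Real.exp 1 := by
            gcongr
            · linarith [hy.2]
            · exact h1.trans (Real.exp_le_exp.2 h2)
        _ = _ := one_mul _)
  rw [regularPart, norm_neg]
  refine h.trans ?_
  rw [sub_zero, abs_of_nonneg (by linarith [hx.2])]
  nlinarith [Real.exp_pos 1, hx.1]

lemma differentiable_regularPart (x : ℝ) : Differentiable ℂ (regularPart x) := by
  have h := differentiable_integral_exp_mul (a := 0) (b := 1 - x)
    (f := fun y : ℝ => ((y + x : ℝ) : ℂ)) (Continuous.intervalIntegrable (by fun_prop) _ _)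
  have e : regularPart x = fun z : ℂ => -(((∫ y in (0 : ℝ)..(1 - x),
      Complex.exp (-(Complex.I * z) * y) * ((y + x : ℝ) : ℂ))
      - ∫ y in (0 : ℝ)..(1 - x), Complex.exp ((Complex.I * z) * y) * ((y + x : ℝ) : ℂ))
        * (Complex.I / 2)) := by
    ext z
    rw [regularPart, ← intervalIntegral.integral_sub
      (Continuous.intervalIntegrable (by fun_prop) _ _)
      (Continuous.intervalIntegrable (by fun_prop) _ _), ← intervalIntegral.integral_mul_const]
    congr 1
    refine intervalIntegral.integral_congr fun y _ => ?_
    rw [Complex.sin, show -(z * (y : ℂ)) * Complex.I = -(Complex.I * z) * y by ring,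
      show z * (y : ℂ) * Complex.I = Complex.I * z * y by ring]
    ring
  rw [e]
  have h1 : Differentiable ℂ fun z : ℂ => ∫ y in (0 : ℝ)..(1 - x),
      Complex.exp (-(Complex.I * z) * y) * ((y + x : ℝ) : ℂ) :=
    h.comp (g := fun z : ℂ => ∫ y in (0 : ℝ)..(1 - x), Complex.exp (z * y) * ((y + x : ℝ) : ℂ))
      (f := fun z : ℂ => -(Complex.I * z)) (by fun_prop)
  have h2 : Differentiable ℂ fun z : ℂ => ∫ y in (0 : ℝ)..(1 - x),
      Complex.exp ((Complex.I * z) * y) * ((y + x : ℝ) : ℂ) :=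
    h.comp (g := fun z : ℂ => ∫ y in (0 : ℝ)..(1 - x), Complex.exp (z * y) * ((y + x : ℝ) : ℂ))
      (f := fun z : ℂ => Complex.I * z) (by fun_prop)
  exact ((h1.sub h2).mul_const _).neg

lemma norm_exp_neg_sq_mul_le {t : ℝ} (ht : 0 < t) (σ : ℝ) {v : ℝ} (hv : v ∈ Icc (0 : ℝ) 1) :
    ‖Complex.exp (-((σ + v * Complex.I) ^ 2 * t))‖
      ≤ Real.exp t * (1 + 1 / t) / (1 + σ ^ 2) := by
  rw [Complex.norm_exp, Complex.neg_re, Complex.re_mul_ofReal, sq_re_line]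
  have h1 : -((σ ^ 2 - v ^ 2) * t) ≤ t + -(t * σ ^ 2) := by
    have : v ^ 2 ≤ 1 := by nlinarith [hv.1, hv.2]
    nlinarith
  calc _ ≤ Real.exp t * Real.exp (-(t * σ ^ 2)) := by
        rw [← Real.exp_add]; exact Real.exp_le_exp.2 h1
    _ ≤ Real.exp t * ((1 + 1 / t) / (1 + σ ^ 2)) := by
        refine mul_le_mul_of_nonneg_left ?_ (Real.exp_pos t).le
        exact (exp_neg_le_inv_one_add (by positivity)).trans (one_div_one_add_mul_sq_le ht σ)
    _ = _ := by ring

/-- Shift of an entire integrand with Gaussian decay from the real line to `Im z = 1`. -/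
lemma integral_gaussian_mul_shift {f : ℂ → ℂ} (hf : Differentiable ℂ f) {t B : ℝ} (ht : 0 < t)
    (hB : ∀ z : ℂ, z.im ∈ Icc (0 : ℝ) 1 → ‖f z‖ ≤ B) :
    (Integrable fun σ : ℝ => Complex.exp (-((σ + Complex.I) ^ 2 * t)) * f (σ + Complex.I)) ∧
    ∫ σ : ℝ, Complex.exp (-((σ : ℂ) ^ 2 * t)) * f σ
      = ∫ σ : ℝ, Complex.exp (-((σ + Complex.I) ^ 2 * t)) * f (σ + Complex.I) := by
  have h := integral_horizontal_line_eq_of_decay (a := 0) (b := 1)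
    (f := fun z => Complex.exp (-(z ^ 2 * t)) * f z)
    (C := Real.exp t * (1 + 1 / t) * B) zero_le_one
    (fun z _ => DifferentiableAt.mul (by fun_prop) (hf z)) (fun σ v hv => by
      rw [norm_mul]
      calc _ ≤ Real.exp t * (1 + 1 / t) / (1 + σ ^ 2) * B :=
            mul_le_mul (norm_exp_neg_sq_mul_le ht σ hv) (hB _ (by simpa using hv))
              (norm_nonneg _) (by positivity)
        _ = _ := by ring)
  have h1 := h.1 1 ⟨zero_le_one, le_rfl⟩
  have h2 := h.2
  simp only [Complex.ofReal_zero, Complex.ofReal_one, zero_mul, one_mul, add_zero] at h1 h2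
  exact ⟨h1, h2⟩

/-- Being entire, the integrand can be moved down to the real axis, where it is odd. -/
lemma integral_gaussian_mul_regularPart {x t : ℝ} (hx : x ∈ Icc (0 : ℝ) 1) (ht : 0 < t) :
    (Integrable fun σ : ℝ =>
      Complex.exp (-((σ + Complex.I) ^ 2 * t)) * regularPart x (σ + Complex.I)) ∧
    ∫ σ : ℝ, Complex.exp (-((σ + Complex.I) ^ 2 * t)) * regularPart x (σ + Complex.I) = 0 := by
  obtain ⟨h1, h2⟩ := integral_gaussian_mul_shift (differentiable_regularPart x) ht
    (fun z hz => norm_regularPart_le hx (by rw [abs_of_nonneg hz.1]; exact hz.2))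
  refine ⟨h1, h2 ▸ integral_eq_zero_of_odd fun σ => ?_⟩
  push_cast
  rw [neg_sq, regularPart_neg, mul_neg]

lemma integrable_gaussian_div {t : ℝ} (ht : 0 < t) :
    Integrable fun σ : ℝ => Complex.exp (-((σ + Complex.I) ^ 2 * t)) / (σ + Complex.I) := by
  have hne : ∀ σ : ℝ, (σ + Complex.I : ℂ) ≠ 0 := fun σ h => by simpa using congrArg Complex.im h
  refine (integrable_const_div_one_add_sq (Real.exp t * (1 + 1 / t))).mono' ?_
    (ae_of_all _ fun σ => ?_)
  · exact (Continuous.div (by fun_prop) (by fun_prop) hne).aestronglyMeasurable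
  · have h1 := norm_exp_neg_sq_mul_le ht σ (v := 1) ⟨zero_le_one, le_rfl⟩
    simp only [Complex.ofReal_one, one_mul] at h1
    rw [norm_div]
    refine le_trans (div_le_self (norm_nonneg _) ?_) h1
    have := Complex.abs_im_le_norm (σ + Complex.I : ℂ)
    simpa using this

/-- For the stationary initial value `x` only the residue at the origin contributes. -/
lemma lineSolution_id {x t : ℝ} (hx : x ∈ Icc (0 : ℝ) 1) (ht : 0 < t) :
    lineSolution (fun y => y) 0 x t = x * (Complex.I / Real.pi *
      ∫ σ : ℝ, Complex.exp (-((σ + Complex.I) ^ 2 * t)) / (σ + Complex.I)) := by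
  have hid : ContinuousOn (fun y : ℝ => y) (Icc 0 1) := by fun_prop
  obtain ⟨K, hK⟩ := exists_abs_le_of_continuousOn hid
  have hK0 : 0 ≤ K := (abs_nonneg _).trans (hK 0 ⟨le_rfl, zero_le_one⟩)
  have hreal : ∀ z : ℂ, integrandReal (fun y => y) x t z = Complex.exp (-(z ^ 2 * t))
      * (Complex.exp (Complex.I * z * x) * uHat (fun y => y) (-(Complex.I * z))) := by
    intro z
    rw [integrandReal, elem_eq]
    ring
  have hB : ∀ z : ℂ, z.im ∈ Icc (0 : ℝ) 1 →
      ‖Complex.exp (Complex.I * z * x) * uHat (fun y => y) (-(Complex.I * z))‖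
        ≤ Real.exp 1 * K := by
    intro z hz
    have h1 : ‖Complex.exp (Complex.I * z * x)‖ ≤ 1 :=
      norm_exp_mul_ofReal_le_one (by simp; exact hz.1) hx.1
    have h2 : ‖uHat (fun y => y) (-(Complex.I * z))‖ ≤ Real.exp 1 * K := by
      have h4 := norm_integral_exp_mul_le (f := fun y => 1 - y) (K := K) (fun y hy =>
        hK (1 - y) ⟨by linarith [hy.2], by linarith [hy.1]⟩) (w := Complex.I * z)
        (by simp; exact hz.1)
      rw [← exp_mul_uHat_neg (fun y => y), norm_mul, norm_exp_I_mul, Real.exp_neg, inv_mul_eq_div,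
        div_le_iff₀ (Real.exp_pos _)] at h4
      refine h4.trans ?_
      rw [mul_comm]
      gcongr
      exact hz.2
    rw [norm_mul]
    calc _ ≤ 1 * (Real.exp 1 * K) := by gcongr
      _ = _ := one_mul _
  have hdiff : Differentiable ℂ fun z : ℂ =>
      Complex.exp (Complex.I * z * x) * uHat (fun y => y) (-(Complex.I * z)) := by
    have := differentiable_uHat hid
    fun_prop
  -- The real integral is lifted to Im z = 1 so that all three integrands can be added pointwise.
  obtain ⟨hi1, hs⟩ := integral_gaussian_mul_shift hdiff ht hB
  obtain ⟨hi4, hreg⟩ := integral_gaussian_mul_regularPart hx ht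
  have hi2 := integrable_kern (j := 0) (K := 0) (holoBounded_coefPlus hid) holoBounded_fluxPlus hx.1
    ht (by simp) intervalIntegrable_const
  have hi3 := integrable_kern (j := 0) (K := 0) (holoBounded_coefMinus hid) holoBounded_fluxMinus
    (sub_nonneg.2 hx.2) ht (by simp) intervalIntegrable_const
  have hi5 := integrable_gaussian_div ht
  -- The terms e^{izx}/z² cancel. What remains is 2i(z cos z(1-x) - sin z(1-x))/z², which is 2i
  -- times the regular part plus 2ix/z.
  have hpt : ∀ σ : ℝ, Complex.exp (-((σ + Complex.I) ^ 2 * t)) *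
      (Complex.exp (Complex.I * (σ + Complex.I) * x)
        * uHat (fun y => y) (-(Complex.I * (σ + Complex.I))))
      - kern (coefPlus fun y => y) fluxPlus 0 x t (σ + Complex.I)
      + kern (coefMinus fun y => y) fluxMinus 0 (1 - x) t (σ + Complex.I)
      = 2 * Complex.I * (Complex.exp (-((σ + Complex.I) ^ 2 * t)) * regularPart x (σ + Complex.I))
        + 2 * Complex.I * x * (Complex.exp (-((σ + Complex.I) ^ 2 * t)) / (σ + Complex.I)) := by
    intro σ
    have him : 0 < (σ + Complex.I : ℂ).im := by simp
    generalize (σ + Complex.I : ℂ) = z at him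
    have hz0 : z ≠ 0 := by rintro rfl; simp at him
    have hI := Complex.I_ne_zero
    rw [kern_zero_flux, kern_zero_flux, coefPlus_id him, coefMinus_id him,
      regularPart_eq hz0, uHat_id (neg_ne_zero.2 (mul_ne_zero hI hz0))]
    have e1 : Complex.exp (Complex.I * z * x) * Complex.exp (-(Complex.I * z))
        = Complex.cos (z * (1 - x)) - Complex.sin (z * (1 - x)) * Complex.I := by
      rw [← Complex.exp_add, show Complex.I * z * x + -(Complex.I * z)
        = (-(z * (1 - x))) * Complex.I by ring, Complex.exp_mul_I, Complex.cos_neg, Complex.sin_neg]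
      ring
    have e2 : Complex.exp (Complex.I * z * (1 - x : ℝ))
        = Complex.cos (z * (1 - x)) + Complex.sin (z * (1 - x)) * Complex.I := by
      rw [show Complex.I * z * (1 - x : ℝ) = (z * (1 - x)) * Complex.I by push_cast; ring,
        Complex.exp_mul_I]
    have e3 : Complex.exp (Complex.I * z * x) * (Complex.exp (-(Complex.I * z)) / -(Complex.I * z)
        - (Complex.exp (-(Complex.I * z)) - 1) / (-(Complex.I * z)) ^ 2)
        = (Complex.exp (Complex.I * z * x) * Complex.exp (-(Complex.I * z))) * (1 + Complex.I * z)
          / z ^ 2 - Complex.exp (Complex.I * z * x) / z ^ 2 := by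
      rw [neg_sq, mul_pow, Complex.I_sq]
      have : (1 : ℂ) / -(Complex.I * z) = Complex.I / z := by
        field_simp
        rw [Complex.I_sq]
      rw [div_eq_mul_one_div _ (-(Complex.I * z)), this]
      field_simp
      ring
    rw [e3, e1, e2]
    field_simp
    ring
  have hsum : (∫ l : ℝ, integrandReal (fun y => y) x t l)
      - (∫ σ : ℝ, kern (coefPlus fun y => y) fluxPlus 0 x t (σ + Complex.I))
      + (∫ σ : ℝ, kern (coefMinus fun y => y) fluxMinus 0 (1 - x) t (σ + Complex.I))
      = 2 * Complex.I * x
        * ∫ σ : ℝ, Complex.exp (-((σ + Complex.I) ^ 2 * t)) / (σ + Complex.I) := by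
    have hi12 := hi1.sub hi2
    simp only [Pi.sub_def] at hi12
    simp only [hreal]
    rw [hs, ← integral_sub hi1 hi2, ← integral_add hi12 hi3]
    simp only [hpt]
    rw [integral_add (hi4.const_mul _) (hi5.const_mul _), integral_const_mul, integral_const_mul,
      hreg, mul_zero, zero_add]
  rw [lineSolution, hsum]
  generalize (∫ σ : ℝ, Complex.exp (-((σ + Complex.I) ^ 2 * t)) / (σ + Complex.I)) = Q
  have : (Real.pi : ℂ) ≠ 0 := by exact_mod_cast Real.pi_ne_zero
  field_simp

lemma line_ne_zero (σ : ℝ) : (σ + Complex.I : ℂ) ≠ 0 := fun h => by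
  simpa using congrArg Complex.im h

/-- Since (σ + i)² = σ² + 2iσ - 1, the two Gaussians differ by the factor e^w with w = t(1 - 2iσ),
and |e^w - 1| ≤ |w|e^{|w|}. The linear growth of |w| in σ cancels against the denominator, leaving t
times a Gaussian of width t^{-1/2}, whose integral is O(√t). -/
lemma norm_gaussian_sub_div_le {t : ℝ} (ht : 0 < t) (σ : ℝ) :
    ‖(Complex.exp (-((σ + Complex.I) ^ 2 * t)) - Complex.exp (-((σ : ℂ) ^ 2 * t)))
      / (σ + Complex.I)‖ ≤ 3 * t * Real.exp (3 * t) * Real.exp (-(t / 2) * σ ^ 2) := by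
  set w : ℂ := t * (1 - 2 * Complex.I * σ) with hw
  have e : Complex.exp (-((σ + Complex.I) ^ 2 * t)) - Complex.exp (-((σ : ℂ) ^ 2 * t))
      = Complex.exp (-((σ : ℂ) ^ 2 * t)) * (Complex.exp w - 1) := by
    rw [mul_sub, ← Complex.exp_add, mul_one]
    congr 2
    rw [hw]
    linear_combination (-(t : ℂ)) * Complex.I_sq
  have hwn : ‖w‖ ≤ t * (1 + 2 * |σ|) := by
    rw [hw, norm_mul, Complex.norm_real, Real.norm_of_nonneg ht.le]
    gcongr
    refine (norm_sub_le _ _).trans ?_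
    simp
  have h1 : ‖Complex.exp w - 1‖ ≤ ‖w‖ * Real.exp ‖w‖ := by
    simpa using Complex.norm_exp_sub_sum_le_norm_mul_exp w 1
  have h2 : ‖Complex.exp (-((σ : ℂ) ^ 2 * t))‖ = Real.exp (-(σ ^ 2 * t)) := by
    rw [Complex.norm_exp]
    congr 1
    rw [← Complex.ofReal_pow, ← Complex.ofReal_mul, Complex.neg_re, Complex.ofReal_re]
  have h3 : (1 + 2 * |σ|) ≤ 3 * ‖(σ + Complex.I : ℂ)‖ := by
    have a := Complex.abs_re_le_norm (σ + Complex.I : ℂ)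
    have b := Complex.abs_im_le_norm (σ + Complex.I : ℂ)
    simp at a b
    linarith
  have hpos : 0 < ‖(σ + Complex.I : ℂ)‖ := norm_pos_iff.2 (line_ne_zero σ)
  have hexp : Real.exp (-(σ ^ 2 * t)) * Real.exp (t * (1 + 2 * |σ|))
      ≤ Real.exp (3 * t) * Real.exp (-(t / 2) * σ ^ 2) := by
    rw [← Real.exp_add, ← Real.exp_add]
    refine Real.exp_le_exp.2 ?_
    -- Half of the Gaussian exponent is spent on absorbing e^{2t|σ|}.
    have : 2 * |σ| ≤ 2 + σ ^ 2 / 2 := by nlinarith [sq_nonneg (|σ| - 2), sq_abs σ]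
    nlinarith
  rw [e, norm_div, norm_mul, h2, div_le_iff₀ hpos]
  calc Real.exp (-(σ ^ 2 * t)) * ‖Complex.exp w - 1‖
      ≤ Real.exp (-(σ ^ 2 * t)) * ((t * (1 + 2 * |σ|)) * Real.exp (t * (1 + 2 * |σ|))) := by
        refine mul_le_mul_of_nonneg_left (h1.trans ?_) (Real.exp_pos _).le
        gcongr
    _ = t * (1 + 2 * |σ|) * (Real.exp (-(σ ^ 2 * t)) * Real.exp (t * (1 + 2 * |σ|))) := by ring
    _ ≤ t * (3 * ‖(σ + Complex.I : ℂ)‖) * (Real.exp (3 * t) * Real.exp (-(t / 2) * σ ^ 2)) := by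
        gcongr
    _ = _ := by ring

lemma ofReal_gaussian (t σ : ℝ) :
    Complex.exp (-((σ : ℂ) ^ 2 * t)) = (Real.exp (-(σ ^ 2 * t)) : ℝ) := by
  push_cast
  rfl

lemma integrable_gaussian_div_one_add_sq (t : ℝ) (ht : 0 < t) :
    Integrable fun σ : ℝ => Real.exp (-(σ ^ 2 * t)) / (1 + σ ^ 2) := by
  refine (integrable_const_div_one_add_sq 1).mono' ?_ (ae_of_all _ fun σ => ?_)
  · exact (Continuous.div (by fun_prop) (by fun_prop) fun σ => by positivity).aestronglyMeasurable
  · rw [Real.norm_of_nonneg (by positivity)]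
    gcongr
    exact Real.exp_le_one_iff.2 (by nlinarith [mul_nonneg (sq_nonneg σ) ht.le])

lemma tendsto_integral_gaussian_div_one_add_sq :
    Tendsto (fun t : ℝ => ∫ σ : ℝ, Real.exp (-(σ ^ 2 * t)) / (1 + σ ^ 2)) (𝓝[>] 0)
      (𝓝 Real.pi) := by
  rw [← integral_univ_inv_one_add_sq]
  refine tendsto_integral_filter_of_dominated_convergence (fun σ => 1 / (1 + σ ^ 2)) ?_ ?_
    (integrable_const_div_one_add_sq 1) ?_
  · filter_upwards [self_mem_nhdsWithin] with t ht
    exact (integrable_gaussian_div_one_add_sq t ht).aestronglyMeasurable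
  · filter_upwards [self_mem_nhdsWithin] with t ht
    have ht : 0 < t := ht
    refine ae_of_all _ fun σ => ?_
    rw [Real.norm_of_nonneg (by positivity)]
    gcongr
    exact Real.exp_le_one_iff.2 (by nlinarith [mul_nonneg (sq_nonneg σ) ht.le])
  · refine ae_of_all _ fun σ => ?_
    have hc : Continuous fun t : ℝ => Real.exp (-(σ ^ 2 * t)) / (1 + σ ^ 2) := by fun_prop
    simpa using (hc.tendsto 0).mono_left nhdsWithin_le_nhds

lemma integrable_gaussian_sq_div {t : ℝ} (ht : 0 < t) :
    Integrable fun σ : ℝ => Complex.exp (-((σ : ℂ) ^ 2 * t)) / (σ + Complex.I) := by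
  refine (integrable_exp_neg_mul_sq ht).mono' ?_ (ae_of_all _ fun σ => ?_)
  · exact (Continuous.div (by fun_prop) (by fun_prop) line_ne_zero).aestronglyMeasurable
  · rw [norm_div, ofReal_gaussian, Complex.norm_real, Real.norm_of_nonneg (Real.exp_pos _).le,
      show -(σ ^ 2 * t) = -t * σ ^ 2 by ring]
    refine div_le_self (Real.exp_pos _).le ?_
    simpa using Complex.abs_im_le_norm (σ + Complex.I : ℂ)

lemma integral_gaussian_sq_div {t : ℝ} (ht : 0 < t) :
    ∫ σ : ℝ, Complex.exp (-((σ : ℂ) ^ 2 * t)) / (σ + Complex.I)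
      = -Complex.I * ((∫ σ : ℝ, Real.exp (-(σ ^ 2 * t)) / (1 + σ ^ 2) : ℝ) : ℂ) := by
  have hi : Integrable fun σ : ℝ => ((Real.exp (-(σ ^ 2 * t)) / (1 + σ ^ 2) : ℝ) : ℂ) :=
    (integrable_gaussian_div_one_add_sq t ht).ofReal
  have hi' := hi.const_mul Complex.I
  rw [← integral_complex_ofReal, ← sub_eq_zero, neg_mul, sub_neg_eq_add, ← integral_const_mul,
    ← integral_add (integrable_gaussian_sq_div ht) hi']
  refine integral_eq_zero_of_odd fun σ => ?_
  have h1 := line_ne_zero σ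
  have h2 := line_ne_zero (-σ)
  have h3 : (1 + (σ : ℂ) ^ 2) ≠ 0 := by
    exact_mod_cast (by positivity : (1 + σ ^ 2 : ℝ) ≠ 0)
  push_cast at h2 ⊢
  rw [neg_sq]
  field_simp
  linear_combination (2 * Complex.I) * Complex.I_sq

/-- The residue at the origin in the limit of small times. -/
lemma tendsto_integral_gaussian_div :
    Tendsto (fun t : ℝ => ∫ σ : ℝ,
      Complex.exp (-((σ + Complex.I) ^ 2 * t)) / (σ + Complex.I)) (𝓝[>] 0)
      (𝓝 (-Complex.I * Real.pi)) := by
  have hA : Tendsto (fun t : ℝ => ∫ σ : ℝ,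
      (Complex.exp (-((σ + Complex.I) ^ 2 * t)) - Complex.exp (-((σ : ℂ) ^ 2 * t)))
        / (σ + Complex.I)) (𝓝[>] 0) (𝓝 0) := by
    have hb : Tendsto (fun t : ℝ => 3 * Real.exp (3 * t) * √(2 * Real.pi * t)) (𝓝[>] 0) (𝓝 0) := by
      have hc : Continuous fun t : ℝ => 3 * Real.exp (3 * t) * √(2 * Real.pi * t) := by fun_prop
      simpa using (hc.tendsto 0).mono_left nhdsWithin_le_nhds
    refine squeeze_zero_norm' ?_ hb
    filter_upwards [self_mem_nhdsWithin] with t ht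
    have ht : 0 < t := ht
    have h := norm_integral_le_of_norm_le
      ((integrable_exp_neg_mul_sq (half_pos ht)).const_mul (3 * t * Real.exp (3 * t)))
      (ae_of_all _ fun σ => norm_gaussian_sub_div_le ht σ)
    refine h.trans (le_of_eq ?_)
    rw [integral_const_mul, integral_gaussian]
    have : √(2 * Real.pi * t) = t * √(Real.pi / (t / 2)) := by
      rw [show 2 * Real.pi * t = t ^ 2 * (Real.pi / (t / 2)) by field_simp,
        Real.sqrt_mul (by positivity), Real.sqrt_sq ht.le]
    rw [this]
    ring
  have hB : Tendsto (fun t : ℝ => -Complex.I *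
      ((∫ σ : ℝ, Real.exp (-(σ ^ 2 * t)) / (1 + σ ^ 2) : ℝ) : ℂ)) (𝓝[>] 0)
      (𝓝 (-Complex.I * Real.pi)) :=
    ((Complex.continuous_ofReal.tendsto _).comp
      tendsto_integral_gaussian_div_one_add_sq).const_mul _
  have hAB := hA.add hB
  rw [zero_add] at hAB
  refine hAB.congr' ?_
  filter_upwards [self_mem_nhdsWithin] with t ht
  have ht : 0 < t := ht
  rw [← integral_gaussian_sq_div ht]
  simp only [sub_div]
  rw [integral_sub (integrable_gaussian_div ht) (integrable_gaussian_sq_div ht), sub_add_cancel]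

/-- Uniform attainment of the initial value `x`. -/
lemma exists_norm_lineSolution_id_sub_le :
    ∃ g : ℝ → ℝ, Tendsto g (𝓝[>] 0) (𝓝 0) ∧ ∀ t : ℝ, 0 < t → ∀ x ∈ Icc (0 : ℝ) 1,
      ‖lineSolution (fun y => y) 0 x t - x‖ ≤ g t := by
  refine ⟨fun t => ‖Complex.I / Real.pi * (∫ σ : ℝ,
    Complex.exp (-((σ + Complex.I) ^ 2 * t)) / (σ + Complex.I)) - 1‖, ?_, fun t ht x hx => ?_⟩
  · have h := ((tendsto_integral_gaussian_div.const_mul (Complex.I / Real.pi)).sub_const 1).norm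
    have hpi : (Real.pi : ℂ) ≠ 0 := by exact_mod_cast Real.pi_ne_zero
    have e : Complex.I / Real.pi * (-Complex.I * Real.pi) - 1 = 0 := by
      field_simp
      rw [Complex.I_sq]
      ring
    rwa [e, norm_zero] at h
  · rw [lineSolution_id hx ht, ← mul_sub_one, norm_mul, Complex.norm_real,
      Real.norm_of_nonneg hx.1]
    exact mul_le_of_le_one_left (norm_nonneg _) hx.2

/-! ### Superposition of the three contributions -/

/-- The solution attains its initial value uniformly on `[0, 1]`. -/
lemma tendstoUniformlyOn_lineSolution {u₀ j : ℝ → ℝ} (hj : HasPiecewiseContinuousDeriv j)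
    (hu₀ : ContDiffOn ℝ 2 u₀ (Icc 0 1)) (hu₀0 : u₀ 0 = 0) :
    TendstoUniformlyOn (fun t x => lineSolution u₀ j x t) (fun x => (u₀ x : ℂ)) (𝓝[>] 0)
      (Icc 0 1) := by
  -- With this a the remainder u₀ - ax vanishes at x = 1; at x = 0 it does so by hypothesis.
  set a := u₀ 1 with ha
  set w : ℝ → ℝ := fun x => u₀ x - a * x with hwdef
  have hw : ContDiffOn ℝ 2 w (Icc 0 1) := hu₀.sub (by fun_prop)
  obtain ⟨K, hK⟩ := hj.exists_abs_le one_pos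
  obtain ⟨g₁, hg₁, h₁⟩ := exists_norm_lineSolution_id_sub_le
  obtain ⟨g₂, hg₂, h₂⟩ := exists_norm_lineSolution_sub_le hw (by simp [hwdef, hu₀0])
    (by simp [hwdef, ha])
  obtain ⟨g₃, hg₃, h₃⟩ := exists_norm_lineSolution_flux_le hK
  have hg : Tendsto (fun t => |a| * g₁ t + g₂ t + g₃ t) (𝓝[>] 0) (𝓝 0) := by
    simpa using ((hg₁.const_mul |a|).add hg₂).add hg₃
  rw [Metric.tendstoUniformlyOn_iff]
  intro ε hε
  filter_upwards [hg.eventually (gt_mem_nhds hε), Ioc_mem_nhdsGT one_pos] with t hgt ht x hx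
  have hKt : ∀ s ∈ Icc 0 t, |j s| ≤ K := fun s hs => hK s ⟨hs.1, hs.2.trans ht.2⟩
  have hji := hj.intervalIntegrable ht.1
  have hu : u₀ = fun x => a * (fun y => y) x + w x := by ext x; simp [hwdef]
  have hww : w = fun x => 1 * w x + (fun _ => 0) x := by ext x; simp
  have e1 : lineSolution u₀ j x t
      = a * lineSolution (fun y => y) 0 x t + lineSolution w j x t := by
    conv_lhs => rw [hu]
    exact lineSolution_linear (by fun_prop) hw.continuousOn a hx ht.1 hKt hji
  have e2 : lineSolution w j x t = lineSolution w 0 x t + lineSolution (fun _ => 0) j x t := by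
    conv_lhs => rw [hww]
    rw [lineSolution_linear hw.continuousOn (by fun_prop) 1 hx ht.1 hKt hji]
    simp
  have e3 : lineSolution u₀ j x t - u₀ x = a * (lineSolution (fun y => y) 0 x t - x)
      + (lineSolution w 0 x t - w x) + lineSolution (fun _ => 0) j x t := by
    rw [e1, e2, hwdef]
    push_cast
    ring
  rw [dist_comm, dist_eq_norm, e3]
  refine lt_of_le_of_lt ((norm_add₃_le).trans ?_) hgt
  rw [norm_mul, Complex.norm_real, Real.norm_eq_abs]
  have := mul_le_mul_of_nonneg_left (h₁ t ht.1 x hx) (abs_nonneg a)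
  linarith [h₂ t ht.1 x hx, h₃ t ht x hx]

end SingleParticle

end

/-- The integral representation defines a function `u` on `[0, 1] × (0, ∞)`, and `u(·, t) → u₀`
uniformly on the closed interval `[0, 1]` as `t ↓ 0`. -/
theorem mainTheorem5 (u₀ j : ℝ → ℝ)
    (hj : SingleParticle.HasPiecewiseContinuousDeriv j)
    (hu₀ : ContDiffOn ℝ 2 u₀ (Set.Icc 0 1)) (hu₀0 : u₀ 0 = 0) :
    ∃ u : ℝ → ℝ → ℂ, SingleParticle.IsRepresentedSolution u₀ j u ∧
      TendstoUniformlyOn (fun t x => u x t) (fun x => (u₀ x : ℂ))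
        (nhdsWithin 0 (Set.Ioi 0)) (Set.Icc 0 1) :=
  ⟨SingleParticle.lineSolution u₀ j,
    SingleParticle.isRepresentedSolution_lineSolution hu₀.continuousOn hj,
    SingleParticle.tendstoUniformlyOn_lineSolution hj hu₀ hu₀0⟩
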